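/- Let $(a_n)_{n\ge 1}$ be a (not necessarily strictly) decreasing sequence of positive numbers with $\sum_n a_n<\infty$, and set $b_n=\sum_{j=1}^n 8a_j$ ($b_0=0$) and $b=\lim_n b_n$. For $s>0$ put $y_1(s)=s^{-3/2}-s^{-1}$, $y_2(s)=s^{-1/2}-s^{-1}$ and let $$V_s(x)=y_1\delta(x-s)+y_2\delta(x-2s)+y_2\delta(x-3s)+y_1\delta(x-4s)+y_2\delta(x-5s)+y_1\delta(x-6s)+y_1\delta(x-7s)+y_2\delta(x-8s),$$ with $y_i=y_i(s)$. On $(0,b)$ consider the potential $$V_\omega(x)=\sum_{n\ge1}V_{a_n}(x-b_{n-1})+\sum_{n\ge1}g_n^\omega\,\delta(x-b_n),$$ where $(g_n)_{n\ge1}$ are independent real random variables on a probability space with measure $\nu$ (expectation $\mathbb E$) such that, for some $\lambda>0$: (i) $\mathbb E(g_n^2)=\lambda^2n^{-1}$ for all $n\geq 1$, and there is $C_4>0$ with $\mathbb E(g_n^4)\le C_4\lambda^4n^{-2}$ for all $n\ge1$; (ii) $\mathbb E(g_n)=0$ for all $n\ge1$; (iii) for some $\epsilon>0$ and $C_1>0$,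 $\sup_\omega|g_n^\omega|\le C_1n^{-1/3-\epsilon}$ for all $n\ge1$; (iv) $g_n$ is independent of $(g_j)_{j=1}^{n-1}$ for all $n\geq 1$. A real solution of $-u''+V_\omega u=Eu$ on $[0,b)$ is a continuous $u$ with $-u''=Eu$ away from the point masses, such that $u'$ (taken continuous from the right) jumps at each point mass $\gamma\,\delta(x-x_0)$ by $\gamma\,u(x_0)$. Fix $\phi\in(0,\pi)$ with $\phi\ne\frac\pi4,\frac\pi2,\frac{3\pi}4$, let $E$ be given by $\cos\phi=1-\frac56E$, and fix initial data $(c,d)\in\mathbb R^2\setminus\{(0,0)\}$ not depending on $\omega$. For the solution $u$ with $u(0)=c$, $u'(0)=d$, define its Prüfer variables $R_n>0$, $\theta_n\in\mathbb R$ ($n\ge0$) by $$\begin{pmatrix}u(b_n)\\u'(b_n)\end{pmatrix}=iR_ne^{i\theta_n}\begin{pmatrix}1\\1-e^{-i\phi}\end{pmatrix}-iR_ne^{-i\theta_n}\begin{pmatrix}1\\1-e^{i\phi}\end{pmatrix}.$$ Then, for $\nu$-a.e. $\omega$, $$\lim_{n\to\infty}\frac{\ln R_n}{\sum_{j=1}^n\frac1j}=\frac{\lambda^2}{8\sin^2\phi}.$$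 -/

import Mathlib

open MeasureTheory ProbabilityTheory Filter Topology

namespace DeltaCombModel

/-- The strength `y₁(s) = s^(-3/2) - s^(-1)`. -/
noncomputable def y₁ (s : ℝ) : ℝ := s ^ (-(3 / 2) : ℝ) - s⁻¹

/-- The strength `y₂(s) = s^(-1/2) - s^(-1)`. -/
noncomputable def y₂ (s : ℝ) : ℝ := s ^ (-(1 / 2) : ℝ) - s⁻¹

/-- Strengths of the eight point masses, located at `s, 2s, …, 8s`, of the cell potential `V_s`
(the index `k : Fin 8` stands for the point `(k + 1) s`). -/
noncomputable def cellStrength (s : ℝ) : Fin 8 → ℝ :=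
  ![y₁ s, y₂ s, y₂ s, y₁ s, y₂ s, y₁ s, y₁ s, y₂ s]

/-- `b_n = ∑_{j=1}^n 8 a_j` (so `b_0 = 0`); the value `a 0` is never used. -/
noncomputable def bPt (a : ℕ → ℝ) (n : ℕ) : ℝ := ∑ j ∈ Finset.Icc 1 n, 8 * a j

/-- The right endpoint `b = ∑_{j ≥ 1} 8 a_j` of the interval. -/
noncomputable def bEnd (a : ℕ → ℝ) : ℝ := ∑' j : ℕ, 8 * a (j + 1)

/-- The `k`-th site in the cell `(b_n, b_{n+1}]`, that is `b_n + (k + 1) a_{n+1}`, `0 ≤ k ≤ 7`.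
For `k = 7` this is `b_{n+1}`. -/
noncomputable def site (a : ℕ → ℝ) (n : ℕ) (k : Fin 8) : ℝ :=
  bPt a n + ((k : ℕ) + 1 : ℝ) * a (n + 1)

/-- The strength at `site a n k` of the comb
`V = V_0 + ∑_{n ≥ 1} g_n δ(x - b_n)`, where `V_0 = ∑_{n ≥ 1} V_{a_n}(x - b_{n-1})`. -/
noncomputable def strength (a g : ℕ → ℝ) (n : ℕ) (k : Fin 8) : ℝ :=
  cellStrength (a (n + 1)) k + if k = 7 then g (n + 1) else 0

/-- `u` is a (real) solution on `[0, b)` of `-u'' + V u = E u`, where `V` is the comb with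
sites `site a n k` and strengths `strength a g n k`; `du` is its derivative, continuous
from the right at every point. At a site, `u'` jumps by the strength times the value of `u`. -/
structure IsSolution (a g : ℕ → ℝ) (E : ℝ) (u du : ℝ → ℝ) : Prop where
  continuousOn : ContinuousOn u (Set.Ico 0 (bEnd a))
  rightContinuous : ∀ x ∈ Set.Ico 0 (bEnd a), ContinuousWithinAt du (Set.Ici x) x
  hasDerivAt : ∀ x ∈ Set.Ioo 0 (bEnd a), (∀ n k, x ≠ site a n k) → HasDerivAt u (du x) x
  hasDerivAt_du : ∀ x ∈ Set.Ioo 0 (bEnd a), (∀ n k, x ≠ site a n k) →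
    HasDerivAt du (-(E * u x)) x
  jump : ∀ n k, Tendsto du (𝓝[<] site a n k)
    (𝓝 (du (site a n k) - strength a g n k * u (site a n k)))

/-- The eigenvector `f_+ = (1, 1 - e^{-iφ})` of the limiting transfer matrix. -/
noncomputable def fPlus (φ : ℝ) : Fin 2 → ℂ := ![1, 1 - Complex.exp (-(Complex.I * φ))]

/-- The eigenvector `f_- = (1, 1 - e^{iφ})` of the limiting transfer matrix. -/
noncomputable def fMinus (φ : ℝ) : Fin 2 → ℂ := ![1, 1 - Complex.exp (Complex.I * φ)]

/-- `R > 0` and `θ` are the Prüfer variables of the real vector `(x, y)`: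
`(x, y) = p f_+ + q f_-` with `p = i R e^{iθ}` and `q = -i R e^{-iθ}`. -/
def IsPrufer (φ x y R θ : ℝ) : Prop :=
  0 < R ∧
    (![(x : ℂ), (y : ℂ)] : Fin 2 → ℂ) =
      (Complex.I * R * Complex.exp (Complex.I * θ)) • fPlus φ +
        (-(Complex.I * R * Complex.exp (-(Complex.I * θ)))) • fMinus φ

end DeltaCombModel

namespace DeltaCombModel

/-! Across one cell a solution is moved by a unimodular matrix `T n`, then by the random shear
`kickMat`. Written in `t = √a`, the cell matrix extends analytically to `t = 0`, with limit `limMat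
φ`, which is elliptic with eigenvalues `e^{±iφ}` (`exists_analyticAt_cellMat`). As `a` decreases to
`0`, `T n` converges and has summable variation (`cellMat_tendsto_and_summable`).

For unimodular `T` the quadratic form `form T v = det(Tv, v)` is `T`-invariant, and near the limit
it is positive definite. Hence `log (form (T n) (v n))` changes only through the variation of `T n`,
which is summable, and through the kick, which contributes `γ · linCoef + γ² · quadCoef + O(|γ|³)`.
Cubes of the couplings are summable by the decay `n^(-1/3-ε)` (`exists_summable_log_form`).

Three sums remain, to be compared with the harmonic sum `harm`. The linear one is a martingale with
variances of order `1/n`, so it is `o(harm)` by convergence with weights `1/harm` and Kronecker's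
lemma. Replacing `γ²` by its mean `λ²/n` costs a martingale with summable variances
(`ae_tendsto_sum_mul_predictable`). In the mean part, `quadCoef` at the limit is `(sin φ)⁻² (1/4 +
Re q / 2 + Re q² / 4)`, where the unit phase `q` asymptotically rotates by `e^{2iφ}` per step. Since
`e^{2iφ}` and `e^{4iφ}` differ from `1`, summation by parts removes the oscillating terms and leaves
`1/(4 sin² φ)` (`isLittleO_sum_quadCoef`).

The limiting form equals `4 sin² φ · R²`, so `2 log R` grows like `λ²/(4 sin² φ) · harm`. -/

/-! ### The free equation on an interval between sites. -/

theorem eq_left_of_hasDerivAt_zero {f : ℝ → ℝ} {x₀ y : ℝ} (h : x₀ < y)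
    (hc : ContinuousOn f (Set.Icc x₀ y)) (hd : ∀ x ∈ Set.Ioo x₀ y, HasDerivAt f 0 x) :
    f y = f x₀ := by
  obtain ⟨z, _, hz⟩ := exists_hasDerivAt_eq_slope f (fun _ => 0) h hc hd
  have : y - x₀ ≠ 0 := by linarith
  field_simp at hz
  linarith

/-- The transfer relation for `-u'' = k² u` across an interval. -/
theorem free_transfer {u du : ℝ → ℝ} {k x₀ x₁ l : ℝ} (hk : 0 < k) (h : x₀ < x₁)
    (hu : ContinuousOn u (Set.Icc x₀ x₁)) (hdu : ContinuousWithinAt du (Set.Ici x₀) x₀)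
    (hu' : ∀ x ∈ Set.Ioo x₀ x₁, HasDerivAt u (du x) x)
    (hdu' : ∀ x ∈ Set.Ioo x₀ x₁, HasDerivAt du (-(k ^ 2 * u x)) x)
    (hl : Tendsto du (𝓝[<] x₁) (𝓝 l)) :
    u x₁ = Real.cos (k * (x₁ - x₀)) * u x₀ + Real.sin (k * (x₁ - x₀)) / k * du x₀ ∧
      l = -(k * Real.sin (k * (x₁ - x₀))) * u x₀ + Real.cos (k * (x₁ - x₀)) * du x₀ := by
  have hcont : ∀ y ∈ Set.Ioo x₀ x₁, ContinuousOn du (Set.Icc x₀ y) := by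
    intro y hy x hx
    rcases eq_or_lt_of_le hx.1 with rfl | hlt
    · exact hdu.mono Set.Icc_subset_Ici_self
    · exact (hdu' x ⟨hlt, hx.2.trans_lt hy.2⟩).continuousAt.continuousWithinAt
  have hlin : ∀ x, HasDerivAt (fun x => k * (x - x₀)) k x := fun x => by
    simpa using ((hasDerivAt_id x).sub_const x₀).const_mul k
  have hs : ∀ x, HasDerivAt (fun x => Real.sin (k * (x - x₀)))
      (Real.cos (k * (x - x₀)) * k) x := fun x => (hlin x).sin
  have hco : ∀ x, HasDerivAt (fun x => Real.cos (k * (x - x₀)))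
      (-Real.sin (k * (x - x₀)) * k) x := fun x => (hlin x).cos
  -- This and `e2` are first integrals: the data at `y` transported freely back to `x₀`. They are
  -- taken for `y < x₁` because `du` has only a left limit at `x₁`; the endpoint is reached by
  -- passing to the limit.
  have e1 : ∀ y ∈ Set.Ioo x₀ x₁,
      u y * Real.cos (k * (y - x₀)) - du y * (Real.sin (k * (y - x₀)) / k) = u x₀ := by
    intro y hy
    have := eq_left_of_hasDerivAt_zero
      (f := fun y => u y * Real.cos (k * (y - x₀)) - du y * (Real.sin (k * (y - x₀)) / k)) hy.1
      (((hu.mono (Set.Icc_subset_Icc_right hy.2.le)).mul (by fun_prop)).sub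
        ((hcont y hy).mul (by fun_prop))) ?_
    · simpa using this
    · intro x hx
      have hx' : x ∈ Set.Ioo x₀ x₁ := ⟨hx.1, hx.2.trans hy.2⟩
      refine (((hu' x hx').mul (hco x)).sub ((hdu' x hx').mul ((hs x).div_const k))).congr_deriv ?_
      field_simp
      ring
  have e2 : ∀ y ∈ Set.Ioo x₀ x₁,
      u y * (k * Real.sin (k * (y - x₀))) + du y * Real.cos (k * (y - x₀)) = du x₀ := by
    intro y hy
    have := eq_left_of_hasDerivAt_zero
      (f := fun y => u y * (k * Real.sin (k * (y - x₀))) + du y * Real.cos (k * (y - x₀))) hy.1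
      (((hu.mono (Set.Icc_subset_Icc_right hy.2.le)).mul (by fun_prop)).add
        ((hcont y hy).mul (by fun_prop))) ?_
    · simpa using this
    · intro x hx
      have hx' : x ∈ Set.Ioo x₀ x₁ := ⟨hx.1, hx.2.trans hy.2⟩
      refine (((hu' x hx').mul ((hs x).const_mul k)).add ((hdu' x hx').mul (hco x))).congr_deriv ?_
      ring
  have hu1 : Tendsto u (𝓝[<] x₁) (𝓝 (u x₁)) :=
    ((hu x₁ ⟨h.le, le_rfl⟩).mono_left
      (by rw [← nhdsWithin_Ioo_eq_nhdsLT h]; exact nhdsWithin_mono _ Set.Ioo_subset_Icc_self))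
  have hc1 : Tendsto (fun y => Real.cos (k * (y - x₀))) (𝓝[<] x₁) (𝓝 (Real.cos (k * (x₁ - x₀)))) :=
    (hco x₁).continuousAt.tendsto.mono_left nhdsWithin_le_nhds
  have hs1 : Tendsto (fun y => Real.sin (k * (y - x₀))) (𝓝[<] x₁) (𝓝 (Real.sin (k * (x₁ - x₀)))) :=
    (hs x₁).continuousAt.tendsto.mono_left nhdsWithin_le_nhds
  have hev : ∀ᶠ y in 𝓝[<] x₁, y ∈ Set.Ioo x₀ x₁ := Ioo_mem_nhdsLT h
  have f1 := tendsto_nhds_unique (((hu1.mul hc1).sub (hl.mul (hs1.div_const k))).congr'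
    (hev.mono e1)) tendsto_const_nhds
  have f2 := tendsto_nhds_unique (((hu1.mul (hs1.const_mul k)).add (hl.mul hc1)).congr'
    (hev.mono e2)) tendsto_const_nhds
  have hsc := Real.sin_sq_add_cos_sq (k * (x₁ - x₀))
  rw [← f1, ← f2]
  constructor
  · field_simp
    linear_combination (-(u x₁ * k)) * hsc
  · field_simp
    linear_combination (-l) * hsc

/-! ### Positions of the sites. -/

section Geometry

variable {a : ℕ → ℝ}

theorem bPt_succ (a : ℕ → ℝ) (n : ℕ) : bPt a (n + 1) = bPt a n + 8 * a (n + 1) := by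
  simp [bPt, Finset.sum_Icc_succ_top]

theorem bPt_zero (a : ℕ → ℝ) : bPt a 0 = 0 := by simp [bPt]

theorem bPt_strictMono (ha : ∀ n ≥ 1, 0 < a n) : StrictMono (bPt a) :=
  strictMono_nat_of_lt_succ fun n => by
    have := ha (n + 1) (by omega)
    rw [bPt_succ]; linarith

theorem bPt_lt_bEnd (ha : ∀ n ≥ 1, 0 < a n) (hs : Summable a) (n : ℕ) : bPt a n < bEnd a := by
  have hs' : Summable fun j : ℕ => 8 * a (j + 1) := ((summable_nat_add_iff 1).2 hs).mul_left 8
  have e : ∀ n, bPt a n = ∑ j ∈ Finset.range n, 8 * a (j + 1) := fun n => by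
    induction n with
    | zero => simp [bPt]
    | succ n ih => rw [bPt_succ, Finset.sum_range_succ, ih]
  refine (bPt_strictMono ha n.lt_succ_self).trans_le ?_
  rw [e]
  exact hs'.sum_le_tsum _ fun j _ => by have := ha (j + 1) (by omega); positivity

/-- Sites of other cells are excluded by monotonicity of `bPt`; within the same cell, dividing by `a
(n + 1)` would give an integer strictly between `k` and `k + 1`. -/
theorem ne_site_of_mem_gap (ha : ∀ n ≥ 1, 0 < a n) {n k : ℕ} (hk : k < 8) {x : ℝ}
    (hx : x ∈ Set.Ioo (bPt a n + k * a (n + 1)) (bPt a n + (k + 1) * a (n + 1))) (m : ℕ)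
    (j : Fin 8) : x ≠ site a m j := by
  have hn := ha (n + 1) (by omega)
  have hm := ha (m + 1) (by omega)
  have hj : (j : ℝ) + 1 ≤ 8 := by exact_mod_cast j.2
  have hk' : (k : ℝ) + 1 ≤ 8 := by exact_mod_cast hk
  have hk0 : (0 : ℝ) ≤ k := by positivity
  have hj0 : (0 : ℝ) ≤ (j : ℕ) := by positivity
  rintro rfl
  obtain ⟨h1, h2⟩ := hx
  unfold site at h1 h2
  rcases lt_trichotomy m n with h | rfl | h
  · have := (bPt_strictMono ha).monotone (Nat.succ_le_of_lt h)
    rw [Nat.succ_eq_add_one, bPt_succ] at this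
    nlinarith
  · have h1' : (k : ℝ) < (j : ℕ) + 1 := lt_of_mul_lt_mul_right (by linarith) hn.le
    have h2' : ((j : ℕ) : ℝ) + 1 < k + 1 := lt_of_mul_lt_mul_right (by linarith) hn.le
    have h1'' : k < (j : ℕ) + 1 := by exact_mod_cast h1'
    have h2'' : (j : ℕ) + 1 < k + 1 := by exact_mod_cast h2'
    omega
  · have := (bPt_strictMono ha).monotone (Nat.succ_le_of_lt h)
    rw [Nat.succ_eq_add_one, bPt_succ] at this
    nlinarith

end Geometry

/-! ### Transfer matrices of a cell. -/

/-- Transfer matrix across a free interval of length `s` at energy `k²`. -/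
noncomputable def freeMat (k s : ℝ) : Matrix (Fin 2) (Fin 2) ℝ :=
  !![Real.cos (k * s), Real.sin (k * s) / k; -(k * Real.sin (k * s)), Real.cos (k * s)]

/-- Transfer matrix across a point mass of strength `γ`. -/
def kickMat (γ : ℝ) : Matrix (Fin 2) (Fin 2) ℝ := !![1, 0; γ, 1]

/-- Transfer matrix across the cell potential `V_s`. -/
noncomputable def cellMat (k s : ℝ) : Matrix (Fin 2) (Fin 2) ℝ :=
  (kickMat (y₂ s) * freeMat k s) * (kickMat (y₁ s) * freeMat k s) *
    ((kickMat (y₁ s) * freeMat k s) * (kickMat (y₂ s) * freeMat k s)) *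
    (((kickMat (y₁ s) * freeMat k s) * (kickMat (y₂ s) * freeMat k s)) *
    ((kickMat (y₂ s) * freeMat k s) * (kickMat (y₁ s) * freeMat k s)))

theorem kickMat_add (γ γ' : ℝ) : kickMat (γ + γ') = kickMat γ' * kickMat γ := by
  simp [kickMat, add_comm]

theorem det_freeMat {k : ℝ} (hk : 0 < k) (s : ℝ) : (freeMat k s).det = 1 := by
  simp only [freeMat, Matrix.det_fin_two_of]
  have := Real.sin_sq_add_cos_sq (k * s)
  field_simp
  linarith

theorem det_kickMat (γ : ℝ) : (kickMat γ).det = 1 := by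
  simp [kickMat, Matrix.det_fin_two_of]

theorem det_cellMat {k : ℝ} (hk : 0 < k) (s : ℝ) : (cellMat k s).det = 1 := by
  simp [cellMat, Matrix.det_mul, det_freeMat hk, det_kickMat]

/-- The pair `(u, u')` of a solution evolves from `b_n` to `b_{n+1}` by the cell matrix followed
by the kick of the random coupling. -/
theorem IsSolution.transfer {a g : ℕ → ℝ} {k : ℝ} {u du : ℝ → ℝ} (hk : 0 < k)
    (ha : ∀ n ≥ 1, 0 < a n) (hs : Summable a) (hu : IsSolution a g (k ^ 2) u du) (n : ℕ) :
    ![u (bPt a (n + 1)), du (bPt a (n + 1))] =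
      (kickMat (g (n + 1)) * cellMat k (a (n + 1))).mulVec ![u (bPt a n), du (bPt a n)] := by
  have hn := ha (n + 1) (by omega)
  have hb0 : 0 ≤ bPt a n := by
    rw [← bPt_zero a]; exact (bPt_strictMono ha).monotone (Nat.zero_le n)
  have hb1 : bPt a n + 8 * a (n + 1) < bEnd a := by
    rw [← bPt_succ]; exact bPt_lt_bEnd ha hs _
  have step : ∀ j : Fin 8, ![u (bPt a n + ((j : ℕ) + 1 : ℝ) * a (n + 1)),
      du (bPt a n + ((j : ℕ) + 1 : ℝ) * a (n + 1))] =
      (kickMat (strength a g n j) * freeMat k (a (n + 1))).mulVec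
        ![u (bPt a n + (j : ℕ) * a (n + 1)), du (bPt a n + (j : ℕ) * a (n + 1))] := by
    intro j
    have hj : ((j : ℕ) : ℝ) + 1 ≤ 8 := by exact_mod_cast j.2
    have hj0 : (0 : ℝ) ≤ (j : ℕ) := by positivity
    have h0 : 0 ≤ bPt a n + (j : ℕ) * a (n + 1) := by positivity
    have h1 : bPt a n + ((j : ℕ) + 1 : ℝ) * a (n + 1) < bEnd a := by nlinarith
    have h01 : bPt a n + (j : ℕ) * a (n + 1) < bPt a n + ((j : ℕ) + 1 : ℝ) * a (n + 1) := by
      nlinarith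
    have hgap := fun x hx => ne_site_of_mem_gap ha (n := n) (k := j) j.2 (x := x) hx
    have := free_transfer hk h01
      (hu.continuousOn.mono fun x hx => ⟨h0.trans hx.1, hx.2.trans_lt h1⟩)
      (hu.rightContinuous _ ⟨h0, h01.trans h1⟩)
      (fun x hx => hu.hasDerivAt x ⟨h0.trans_lt hx.1, hx.2.trans h1⟩ (hgap x hx))
      (fun x hx => hu.hasDerivAt_du x ⟨h0.trans_lt hx.1, hx.2.trans h1⟩ (hgap x hx))
      (hu.jump n j)
    have e : bPt a n + ((j : ℕ) + 1 : ℝ) * a (n + 1) - (bPt a n + (j : ℕ) * a (n + 1)) =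
      a (n + 1) := by ring
    rw [e] at this
    obtain ⟨t1, t2⟩ := this
    unfold site at t2
    have t2' := sub_eq_iff_eq_add.1 t2
    rw [t1] at t2'
    rw [← Matrix.mulVec_mulVec]
    ext i
    fin_cases i
    · simp [kickMat, freeMat, Matrix.mulVec, dotProduct, Fin.sum_univ_two, t1]
    · simp only [kickMat, freeMat, Matrix.mulVec, dotProduct, Fin.sum_univ_two, t2']
      simp
      ring
  set V : ℝ → Fin 2 → ℝ := fun r => ![u (bPt a n + r * a (n + 1)), du (bPt a n + r * a (n + 1))]
    with hV
  have step' : ∀ (j : Fin 8) (r r' γ : ℝ), r = (j : ℕ) → r' = (j : ℕ) + 1 →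
      strength a g n j = γ → V r' = (kickMat γ * freeMat k (a (n + 1))).mulVec (V r) := by
    rintro j _ _ _ rfl rfl rfl
    exact step j
  have s0 := step' 0 0 1 (y₁ (a (n + 1))) (by norm_num) (by norm_num)
    (by simp [strength, cellStrength])
  have s1 := step' 1 1 2 (y₂ (a (n + 1))) (by norm_num) (by norm_num)
    (by simp [strength, cellStrength])
  have s2 := step' 2 2 3 (y₂ (a (n + 1))) (by norm_num) (by norm_num)
    (by simp [strength, cellStrength])
  have s3 := step' 3 3 4 (y₁ (a (n + 1))) (by norm_num) (by norm_num)
    (by simp [strength, cellStrength])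
  have s4 := step' 4 4 5 (y₂ (a (n + 1))) (by norm_num) (by norm_num)
    (by simp [strength, cellStrength])
  have s5 := step' 5 5 6 (y₁ (a (n + 1))) (by norm_num) (by norm_num)
    (by simp [strength, cellStrength])
  have s6 := step' 6 6 7 (y₁ (a (n + 1))) (by norm_num) (by norm_num)
    (by simp [strength, cellStrength])
  -- The eighth site coincides with `b_{n+1}`, so it also carries the random coupling; `kickMat_add`
  -- then splits that kick off as the leftmost factor.
  have s7 := step' 7 7 8 (y₂ (a (n + 1)) + g (n + 1)) (by norm_num) (by norm_num)
    (by simp [strength, cellStrength])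
  have hV0 : V 0 = ![u (bPt a n), du (bPt a n)] := by simp [hV]
  rw [bPt_succ, ← hV0, show ![u (bPt a n + 8 * a (n + 1)), du (bPt a n + 8 * a (n + 1))] = V 8 from
    rfl, s7, s6, s5, s4, s3, s2, s1, s0, cellMat, kickMat_add]
  simp only [Matrix.mulVec_mulVec, Matrix.mul_assoc]

/-! ### Analyticity of the cell matrix in the square root of the cell size. -/

/-- `(sin x - x cos x) / x³` extends analytically across the origin, with value `1/3` there. -/
theorem exists_analyticAt_sin_sub_mul_cos :
    ∃ ψ : ℝ → ℝ, AnalyticAt ℝ ψ 0 ∧ ψ 0 = 1 / 3 ∧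
      ∀ᶠ x in 𝓝 (0 : ℝ), Real.sin x - x * Real.cos x = x ^ 3 * ψ x := by
  have hf : AnalyticAt ℝ (fun x : ℝ => Real.sin x - x * Real.cos x) 0 := by fun_prop
  have d1 : deriv (fun x : ℝ => Real.sin x - x * Real.cos x) = fun x => x * Real.sin x := by
    funext x
    have := ((Real.hasDerivAt_sin x).sub ((hasDerivAt_id x).mul (Real.hasDerivAt_cos x)))
    refine HasDerivAt.deriv (this.congr_deriv ?_)
    simp
  have d2 : deriv (fun x : ℝ => x * Real.sin x) = fun x => Real.sin x + x * Real.cos x := by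
    funext x
    refine HasDerivAt.deriv
      (((hasDerivAt_id x).mul (Real.hasDerivAt_sin x)).congr_deriv ?_)
    simp
  have h3 : ((3 : ℕ) : ℕ∞) ≤ analyticOrderAt (fun x : ℝ => Real.sin x - x * Real.cos x) 0 := by
    rw [natCast_le_analyticOrderAt_iff_iteratedDeriv_eq_zero hf]
    intro i hi
    interval_cases i
    · simp
    · simp [iteratedDeriv_succ]
    · simp [iteratedDeriv_succ, d1]
  obtain ⟨ψ, hψ, he⟩ := (natCast_le_analyticOrderAt hf).1 h3
  simp only [sub_zero, smul_eq_mul] at he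
  refine ⟨ψ, hψ, ?_, he⟩
  -- The factorisation only provides some analytic `ψ`; its value at `0` is read off from the Taylor
  -- bounds for sine and cosine away from `0`.
  have hlim : Tendsto ψ (𝓝[≠] 0) (𝓝 (1 / 3)) := by
    rw [tendsto_iff_norm_sub_tendsto_zero]
    have hz : Tendsto (fun x : ℝ => |x|) (𝓝[≠] 0) (𝓝 0) := by
      have : Continuous fun x : ℝ => |x| := by fun_prop
      simpa using (this.tendsto 0).mono_left nhdsWithin_le_nhds
    refine squeeze_zero' (Eventually.of_forall fun _ => norm_nonneg _) ?_ hz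
    have h1 : ∀ᶠ x in 𝓝[≠] (0 : ℝ), |x| < 1 := hz.eventually (gt_mem_nhds one_pos)
    filter_upwards [h1, nhdsWithin_le_nhds he, self_mem_nhdsWithin] with x hx1 hx hx0
    have hx0' : 0 < |x| := abs_pos.2 hx0
    have b1 := Real.sin_bound hx1.le
    have b2 := Real.cos_bound hx1.le
    have b3 : |x * (Real.cos x - (1 - x ^ 2 / 2))| ≤ |x| * (|x| ^ 4 * (5 / 96)) := by
      rw [abs_mul]; gcongr
    have key : x ^ 3 * (ψ x - 1 / 3) =
        (Real.sin x - (x - x ^ 3 / 6)) - x * (Real.cos x - (1 - x ^ 2 / 2)) := by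
      linear_combination -hx
    have := abs_sub (Real.sin x - (x - x ^ 3 / 6)) (x * (Real.cos x - (1 - x ^ 2 / 2)))
    rw [← key, abs_mul, abs_pow] at this
    rw [Real.norm_eq_abs]
    have h5 : |x| * (|x| ^ 4 * (5 / 96)) ≤ |x| ^ 3 * (|x| / 2) := by
      have : |x| * (|x| ^ 4 * (5 / 96)) = |x| ^ 3 * (|x| * |x| * (5 / 96)) := by ring
      rw [this]; gcongr; nlinarith
    have h6 : |Real.sin x - (x - x ^ 3 / 6)| ≤ |x| ^ 3 * (|x| / 2) := by
      refine b1.trans ?_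
      have : |x| ^ 3 * (|x| / 2) = |x| ^ 4 / 2 := by ring
      rw [this]
      have : (0 : ℝ) ≤ |x| ^ 4 := by positivity
      have : |x| ^ 5 ≤ |x| ^ 4 := pow_le_pow_of_le_one hx0'.le hx1.le (by norm_num)
      linarith
    have h7 : |x| ^ 3 * |ψ x - 1 / 3| ≤ |x| ^ 3 * |x| := by linarith
    exact le_of_mul_le_mul_left h7 (by positivity)
  exact tendsto_nhds_unique (hψ.continuousAt.tendsto.mono_left nhdsWithin_le_nhds) hlim

/-- Two consecutive sites of strengths `y₁, y₂`; here `c` and `c + t⁴ δ` are the two entries of the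
free transfer matrix, and the powers of `t = √s` have been extracted. -/
theorem kick_free_pair₁₂ {t c δ e : ℝ} (ht : t ≠ 0) :
    (!![1, 0; t⁻¹ - (t ^ 2)⁻¹, 1] *
        !![c, t ^ 2 * (c + t ^ 4 * δ); -(e * t ^ 2 * (c + t ^ 4 * δ)), c]) *
      (!![1, 0; (t ^ 3)⁻¹ - (t ^ 2)⁻¹, 1] *
        !![c, t ^ 2 * (c + t ^ 4 * δ); -(e * t ^ 2 * (c + t ^ 4 * δ)), c]) =
    !![t⁻¹ * ((c + t ^ 4 * δ) * c - t ^ 5 * δ * c - e * t ^ 5 * (c + t ^ 4 * δ) ^ 2),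
        t * (2 * t * c * (c + t ^ 4 * δ) + (1 - t) * (c + t ^ 4 * δ) ^ 2);
      t * ((t - 1) * ((1 - t) * c * δ - e * t * (c + t ^ 4 * δ) ^ 2) -
          2 * e * t * (c + t ^ 4 * δ) * c),
        t * ((c + t ^ 4 * δ) * c - t ^ 3 * δ * c - t ^ 2 * δ * (1 - t) ^ 2 * (c + t ^ 4 * δ) -
          e * t ^ 3 * (c + t ^ 4 * δ) ^ 2)] := by
  ext i j
  fin_cases i <;> fin_cases j <;>
  · simp [Matrix.mul_apply, Fin.sum_univ_two]
    field_simp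
    ring

/-- Two consecutive sites of strengths `y₂, y₁`. -/
theorem kick_free_pair₂₁ {t c δ e : ℝ} (ht : t ≠ 0) :
    (!![1, 0; (t ^ 3)⁻¹ - (t ^ 2)⁻¹, 1] *
        !![c, t ^ 2 * (c + t ^ 4 * δ); -(e * t ^ 2 * (c + t ^ 4 * δ)), c]) *
      (!![1, 0; t⁻¹ - (t ^ 2)⁻¹, 1] *
        !![c, t ^ 2 * (c + t ^ 4 * δ); -(e * t ^ 2 * (c + t ^ 4 * δ)), c]) =
    !![t * ((c + t ^ 4 * δ) * c - t ^ 3 * δ * c - e * t ^ 3 * (c + t ^ 4 * δ) ^ 2),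
        t ^ 2 * (2 * c * (c + t ^ 4 * δ) + (t - 1) * (c + t ^ 4 * δ) ^ 2);
      t * ((1 - t) * (t * δ * c - δ * c - e * (c + t ^ 4 * δ) ^ 2) -
          2 * e * t * (c + t ^ 4 * δ) * c),
        t⁻¹ * ((1 - t) * (2 * c * (c + t ^ 4 * δ) + (t - 1) * (c + t ^ 4 * δ) ^ 2) -
          e * t ^ 5 * (c + t ^ 4 * δ) ^ 2 + t * c ^ 2 + t * (t - 1) * c * (c + t ^ 4 * δ))] := by
  ext i j
  fin_cases i <;> fin_cases j <;>
  · simp [Matrix.mul_apply, Fin.sum_univ_two]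
    field_simp
    ring

/-- Cancellation of the singularities. Each kind of pair still has one entry of order `t⁻¹`, but in
the order `P Q Q P` that entry always meets entries with at least one factor `t`, so no negative
power of `t` survives. -/
theorem pair_mul_pair {t p₁ p₂ p₃ p₄ q₁ q₂ q₃ q₄ : ℝ} (ht : t ≠ 0) :
    (!![t⁻¹ * p₁, t * p₂; t * p₃, t * p₄] * !![t * q₁, t ^ 2 * q₂; t * q₃, t⁻¹ * q₄]) *
      (!![t * q₁, t ^ 2 * q₂; t * q₃, t⁻¹ * q₄] * !![t⁻¹ * p₁, t * p₂; t * p₃, t * p₄]) =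
    !![p₁ * q₁ + t ^ 2 * p₂ * q₃, t * p₁ * q₂ + p₂ * q₄;
        t ^ 2 * p₃ * q₁ + t ^ 2 * p₄ * q₃, t ^ 3 * p₃ * q₂ + p₄ * q₄] *
      !![p₁ * q₁ + t ^ 3 * q₂ * p₃, t ^ 2 * q₁ * p₂ + t ^ 3 * q₂ * p₄;
        q₃ * p₁ + q₄ * p₃, t ^ 2 * q₃ * p₂ + q₄ * p₄] := by
  congr 1 <;>
  · ext i j
    fin_cases i <;> fin_cases j <;>
    · simp [Matrix.mul_apply, Fin.sum_univ_two]
      field_simp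

/-- The cell matrix is, as a function of `t = √s`, real analytic up to `t = 0`. -/
theorem exists_analyticAt_cellMat {k : ℝ} (hk : 0 < k) :
    ∃ W : Fin 2 → Fin 2 → ℝ → ℝ, (∀ i j, AnalyticAt ℝ (W i j) 0) ∧
      (∀ i j, W i j 0 = !![1 - 5 / 3 * k ^ 2, 1; -(5 / 3 * k ^ 2), 1] i j) ∧
      ∀ᶠ t in 𝓝[>] (0 : ℝ), ∀ i j, cellMat k (t ^ 2) i j = W i j t := by
  obtain ⟨ψ, hψ, hψ0, hψe⟩ := exists_analyticAt_sin_sub_mul_cos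
  have hin : Tendsto (fun t : ℝ => k * t ^ 2) (𝓝 0) (𝓝 0) := by
    have : Continuous fun t : ℝ => k * t ^ 2 := by fun_prop
    simpa using this.tendsto 0
  set c : ℝ → ℝ := fun t => Real.cos (k * t ^ 2) with hc
  set δ : ℝ → ℝ := fun t => k ^ 2 * ψ (k * t ^ 2) with hδ
  have hca : AnalyticAt ℝ c 0 := by fun_prop
  have hδa : AnalyticAt ℝ δ 0 := by
    have : AnalyticAt ℝ (fun t : ℝ => ψ (k * t ^ 2)) 0 :=
      AnalyticAt.fun_comp (f := fun t : ℝ => k * t ^ 2) (by simpa using hψ) (by fun_prop)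
    exact analyticAt_const.mul this
  have hc0 : c 0 = 1 := by simp [hc]
  have hδ0 : δ 0 = k ^ 2 / 3 := by simp [hδ, hψ0]; ring
  -- Substituting `x = k t²` in `sin x = x cos x + x³ ψ(x)` gives `sin x / k = t² (c + t⁴ δ)` with
  -- `δ = k² ψ`: this is where the correction `t⁴ δ` comes from.
  have hev : ∀ᶠ t in 𝓝[>] (0 : ℝ), freeMat k (t ^ 2) =
      !![c t, t ^ 2 * (c t + t ^ 4 * δ t); -(k ^ 2 * t ^ 2 * (c t + t ^ 4 * δ t)), c t] := by
    filter_upwards [nhdsWithin_le_nhds (hin.eventually hψe)] with t ht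
    have hsin : Real.sin (k * t ^ 2) = k * t ^ 2 * (c t + t ^ 4 * δ t) := by
      simp only [hc, hδ]; linear_combination ht
    rw [freeMat, hsin]
    ext i j
    fin_cases i <;> fin_cases j <;> simp [hc]
    · field_simp
    · ring
  clear_value c δ
  set p₁ : ℝ → ℝ := fun t =>
    (c t + t ^ 4 * δ t) * c t - t ^ 5 * δ t * c t - k ^ 2 * t ^ 5 * (c t + t ^ 4 * δ t) ^ 2 with hp₁
  set p₂ : ℝ → ℝ := fun t =>
    2 * t * c t * (c t + t ^ 4 * δ t) + (1 - t) * (c t + t ^ 4 * δ t) ^ 2 with hp₂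
  set p₃ : ℝ → ℝ := fun t => (t - 1) * ((1 - t) * c t * δ t - k ^ 2 * t * (c t + t ^ 4 * δ t) ^ 2) -
    2 * k ^ 2 * t * (c t + t ^ 4 * δ t) * c t with hp₃
  set p₄ : ℝ → ℝ := fun t => (c t + t ^ 4 * δ t) * c t - t ^ 3 * δ t * c t -
    t ^ 2 * δ t * (1 - t) ^ 2 * (c t + t ^ 4 * δ t) -
    k ^ 2 * t ^ 3 * (c t + t ^ 4 * δ t) ^ 2 with hp₄
  set q₁ : ℝ → ℝ := fun t =>
    (c t + t ^ 4 * δ t) * c t - t ^ 3 * δ t * c t - k ^ 2 * t ^ 3 * (c t + t ^ 4 * δ t) ^ 2 with hq₁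
  set q₂ : ℝ → ℝ := fun t =>
    2 * c t * (c t + t ^ 4 * δ t) + (t - 1) * (c t + t ^ 4 * δ t) ^ 2 with hq₂
  set q₃ : ℝ → ℝ := fun t =>
    (1 - t) * (t * δ t * c t - δ t * c t - k ^ 2 * (c t + t ^ 4 * δ t) ^ 2) -
    2 * k ^ 2 * t * (c t + t ^ 4 * δ t) * c t with hq₃
  set q₄ : ℝ → ℝ := fun t =>
    (1 - t) * (2 * c t * (c t + t ^ 4 * δ t) + (t - 1) * (c t + t ^ 4 * δ t) ^ 2) -
    k ^ 2 * t ^ 5 * (c t + t ^ 4 * δ t) ^ 2 + t * c t ^ 2 +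
    t * (t - 1) * c t * (c t + t ^ 4 * δ t) with hq₄
  have ap₁ : AnalyticAt ℝ p₁ 0 := by fun_prop
  have ap₂ : AnalyticAt ℝ p₂ 0 := by fun_prop
  have ap₃ : AnalyticAt ℝ p₃ 0 := by fun_prop
  have ap₄ : AnalyticAt ℝ p₄ 0 := by fun_prop
  have aq₁ : AnalyticAt ℝ q₁ 0 := by fun_prop
  have aq₂ : AnalyticAt ℝ q₂ 0 := by fun_prop
  have aq₃ : AnalyticAt ℝ q₃ 0 := by fun_prop
  have aq₄ : AnalyticAt ℝ q₄ 0 := by fun_prop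
  have zp₁ : p₁ 0 = 1 := by simp [hp₁, hc0]
  have zp₂ : p₂ 0 = 1 := by simp [hp₂, hc0]
  have zp₃ : p₃ 0 = -(k ^ 2 / 3) := by simp [hp₃, hc0, hδ0]
  have zp₄ : p₄ 0 = 1 := by simp [hp₄, hc0]
  have zq₁ : q₁ 0 = 1 := by simp [hq₁, hc0]
  -- The value of `q₂` at `0` plays no role, since every occurrence of `q₂` in the product has a
  -- positive power of `t` in front. The values of `p₃` and `q₃` add up to the `-5/3 k²` of the
  -- limit.
  have zq₃ : q₃ 0 = -(4 / 3 * k ^ 2) := by simp [hq₃, hc0, hδ0]; ring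
  have zq₄ : q₄ 0 = 1 := by simp [hq₄, hc0]; norm_num
  have hfac : ∀ᶠ t in 𝓝[>] (0 : ℝ), cellMat k (t ^ 2) =
      !![p₁ t * q₁ t + t ^ 2 * p₂ t * q₃ t, t * p₁ t * q₂ t + p₂ t * q₄ t;
        t ^ 2 * p₃ t * q₁ t + t ^ 2 * p₄ t * q₃ t, t ^ 3 * p₃ t * q₂ t + p₄ t * q₄ t] *
      !![p₁ t * q₁ t + t ^ 3 * q₂ t * p₃ t, t ^ 2 * q₁ t * p₂ t + t ^ 3 * q₂ t * p₄ t;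
        q₃ t * p₁ t + q₄ t * p₃ t, t ^ 2 * q₃ t * p₂ t + q₄ t * p₄ t] := by
    filter_upwards [hev, self_mem_nhdsWithin] with t ht htpos
    have ht0 : t ≠ 0 := (Set.mem_Ioi.1 htpos).ne'
    have e₁ : y₁ (t ^ 2) = (t ^ 3)⁻¹ - (t ^ 2)⁻¹ := by
      rw [y₁, ← Real.rpow_natCast, ← Real.rpow_mul (Set.mem_Ioi.1 htpos).le, ← Real.rpow_natCast,
        ← Real.rpow_neg (Set.mem_Ioi.1 htpos).le]
      norm_num
    have e₂ : y₂ (t ^ 2) = t⁻¹ - (t ^ 2)⁻¹ := by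
      rw [y₂, ← Real.rpow_natCast, ← Real.rpow_mul (Set.mem_Ioi.1 htpos).le, ← Real.rpow_neg_one t]
      norm_num
    rw [← pair_mul_pair ht0, cellMat, ht, e₁, e₂, kickMat, kickMat, kick_free_pair₁₂ ht0,
      kick_free_pair₂₁ ht0]
  refine ⟨fun i j t =>
      (!![p₁ t * q₁ t + t ^ 2 * p₂ t * q₃ t, t * p₁ t * q₂ t + p₂ t * q₄ t;
        t ^ 2 * p₃ t * q₁ t + t ^ 2 * p₄ t * q₃ t, t ^ 3 * p₃ t * q₂ t + p₄ t * q₄ t] *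
      !![p₁ t * q₁ t + t ^ 3 * q₂ t * p₃ t, t ^ 2 * q₁ t * p₂ t + t ^ 3 * q₂ t * p₄ t;
        q₃ t * p₁ t + q₄ t * p₃ t, t ^ 2 * q₃ t * p₂ t + q₄ t * p₄ t]) i j, ?_, ?_, ?_⟩
  · clear_value p₁ p₂ p₃ p₄ q₁ q₂ q₃ q₄
    intro i j
    fin_cases i <;> fin_cases j <;>
    · simp only [Matrix.mul_apply, Fin.sum_univ_two]
      simp
      fun_prop
  · intro i j
    fin_cases i <;> fin_cases j <;> simp [zp₁, zp₂, zp₃, zp₄, zq₁, zq₃, zq₄] <;> ring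
  · filter_upwards [hfac] with t ht i j
    rw [ht]

/-- The limiting transfer matrix, of trace `2 cos φ`. -/
noncomputable def limMat (φ : ℝ) : Matrix (Fin 2) (Fin 2) ℝ :=
  !![2 * Real.cos φ - 1, 1; 2 * Real.cos φ - 2, 1]

/-- The entries are analytic, hence Lipschitz near `0`, as functions of `√s`. Since `√(s n)` is
monotone its increments telescope, so mere monotonicity of `s` gives finite total variation. -/
theorem cellMat_tendsto_and_summable {k φ : ℝ} (hk : 0 < k) (hE : Real.cos φ = 1 - 5 / 6 * k ^ 2)
    {s : ℕ → ℝ} (hs : ∀ n, 0 < s n) (hanti : Antitone s) (hs0 : Tendsto s atTop (𝓝 0))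
    (i j : Fin 2) :
    Tendsto (fun n => cellMat k (s n) i j) atTop (𝓝 (limMat φ i j)) ∧
      Summable fun n => |cellMat k (s (n + 1)) i j - cellMat k (s n) i j| := by
  obtain ⟨W, hW, hW0, hWe⟩ := exists_analyticAt_cellMat hk
  have ht : Tendsto (fun n => √(s n)) atTop (𝓝[>] 0) := by
    refine tendsto_nhdsWithin_iff.2 ⟨?_, Eventually.of_forall fun n => Real.sqrt_pos.2 (hs n)⟩
    have := (Real.continuous_sqrt.tendsto 0).comp hs0
    rwa [Real.sqrt_zero] at this
  have he : ∀ᶠ n in atTop, cellMat k (s n) i j = W i j (√(s n)) := by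
    filter_upwards [ht.eventually hWe] with n hn
    rw [← hn i j, Real.sq_sqrt (hs n).le]
  have ht0 := tendsto_nhds_of_tendsto_nhdsWithin ht
  constructor
  · have h0 : W i j 0 = limMat φ i j := by
      rw [hW0, limMat, hE]
      fin_cases i <;> fin_cases j <;> simp <;> ring
    rw [← h0]
    exact ((hW i j).continuousAt.tendsto.comp ht0).congr' (he.mono fun n hn => hn.symm)
  · obtain ⟨K, U, hU, hK⟩ := ((hW i j).contDiffAt (n := 1)).exists_lipschitzOnWith
    have hUe := ht0.eventually hU
    obtain ⟨N, hN⟩ := (he.and hUe).exists_forall_of_atTop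
    rw [← summable_nat_add_iff N]
    have htel : Summable fun n => √(s (n + N)) - √(s (n + 1 + N)) := by
      have hnn : ∀ n, 0 ≤ √(s (n + N)) - √(s (n + 1 + N)) := fun n =>
        sub_nonneg.2 (Real.sqrt_le_sqrt (hanti (by omega)))
      refine summable_of_sum_range_le (c := √(s (0 + N))) hnn fun n => ?_
      rw [Finset.sum_range_sub' (fun n => √(s (n + N)))]
      linarith [Real.sqrt_nonneg (s (n + N))]
    refine Summable.of_nonneg_of_le (fun n => abs_nonneg _) (fun n => ?_) (htel.mul_left (K : ℝ))
    obtain ⟨h1, h1'⟩ := hN (n + N) (by omega)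
    obtain ⟨h2, h2'⟩ := hN (n + N + 1) (by omega)
    rw [h1, h2]
    have := hK.dist_le_mul _ h2' _ h1'
    rw [Real.dist_eq, dist_comm, Real.dist_eq, abs_of_nonneg (sub_nonneg.2
      (Real.sqrt_le_sqrt (hanti (by omega))))] at this
    rw [show n + 1 + N = n + N + 1 by ring]
    exact this

/-! ### The invariant quadratic form and its response to a kick. -/

/-- The quadratic form preserved by a unimodular `2 × 2` matrix. -/
def form (T : Matrix (Fin 2) (Fin 2) ℝ) (v : Fin 2 → ℝ) : ℝ :=
  -(T 1 0) * v 0 ^ 2 + (T 0 0 - T 1 1) * v 0 * v 1 + T 0 1 * v 1 ^ 2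

/-- The first variation of `form T` under a kick. -/
def kickForm (T : Matrix (Fin 2) (Fin 2) ℝ) (v : Fin 2 → ℝ) : ℝ :=
  (T 0 0 - T 1 1) * v 0 ^ 2 + 2 * T 0 1 * v 0 * v 1

/-- The squared Euclidean length. -/
def nsq (v : Fin 2 → ℝ) : ℝ := v 0 ^ 2 + v 1 ^ 2

/-- The `ℓ¹` distance of the entries of two matrices. -/
def entryDist (T T' : Matrix (Fin 2) (Fin 2) ℝ) : ℝ :=
  |T 0 0 - T' 0 0| + |T 0 1 - T' 0 1| + |T 1 0 - T' 1 0| + |T 1 1 - T' 1 1|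

/-- Coefficient of `γ` in the relative change of `form T` under a kick of strength `γ`. -/
noncomputable def linCoef (T : Matrix (Fin 2) (Fin 2) ℝ) (v : Fin 2 → ℝ) : ℝ :=
  kickForm T v / form T v

/-- Coefficient of `γ²` in the change of `log (form T)` under a kick of strength `γ`. -/
noncomputable def quadCoef (T : Matrix (Fin 2) (Fin 2) ℝ) (v : Fin 2 → ℝ) : ℝ :=
  T 0 1 * v 0 ^ 2 / form T v - linCoef T v ^ 2 / 2

theorem mulVec_zero' (T : Matrix (Fin 2) (Fin 2) ℝ) (v : Fin 2 → ℝ) :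
    T.mulVec v 0 = T 0 0 * v 0 + T 0 1 * v 1 := by
  simp [Matrix.mulVec, dotProduct, Fin.sum_univ_two]

theorem mulVec_one' (T : Matrix (Fin 2) (Fin 2) ℝ) (v : Fin 2 → ℝ) :
    T.mulVec v 1 = T 1 0 * v 0 + T 1 1 * v 1 := by
  simp [Matrix.mulVec, dotProduct, Fin.sum_univ_two]

/-- `form T v` is the determinant of the pair `(Tv, v)`, so applying `T` to both vectors multiplies
it by `det T`. -/
theorem form_mulVec {T : Matrix (Fin 2) (Fin 2) ℝ} (hT : T.det = 1) (v : Fin 2 → ℝ) :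
    form T (T.mulVec v) = form T v := by
  rw [Matrix.det_fin_two] at hT
  simp only [form, mulVec_zero', mulVec_one']
  linear_combination (-(T 1 0) * v 0 ^ 2 + (T 0 0 - T 1 1) * v 0 * v 1 + T 0 1 * v 1 ^ 2) * hT

theorem form_kickMat (T : Matrix (Fin 2) (Fin 2) ℝ) (γ : ℝ) (v : Fin 2 → ℝ) :
    form T ((kickMat γ).mulVec v) =
      form T v + γ * kickForm T v + γ ^ 2 * (T 0 1 * v 0 ^ 2) := by
  simp only [form, kickForm, mulVec_zero', mulVec_one', kickMat]
  simp
  ring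

theorem nsq_nonneg (v : Fin 2 → ℝ) : 0 ≤ nsq v := by unfold nsq; positivity

theorem nsq_pos {v : Fin 2 → ℝ} (hv : v ≠ 0) : 0 < nsq v := by
  refine (nsq_nonneg v).lt_of_ne fun h => hv ?_
  unfold nsq at h
  ext i
  fin_cases i
  · simp; nlinarith [sq_nonneg (v 0), sq_nonneg (v 1)]
  · simp; nlinarith [sq_nonneg (v 0), sq_nonneg (v 1)]

theorem abs_le_quad (v : Fin 2 → ℝ) (p q r : ℝ) :
    |p * v 0 ^ 2 + q * v 0 * v 1 + r * v 1 ^ 2| ≤ (|p| + |q| + |r|) * nsq v := by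
  have h0 : v 0 ^ 2 ≤ nsq v := by unfold nsq; nlinarith [sq_nonneg (v 1)]
  have h1 : v 1 ^ 2 ≤ nsq v := by unfold nsq; nlinarith [sq_nonneg (v 0)]
  have h01 : |v 0 * v 1| ≤ nsq v := by
    unfold nsq
    rw [abs_le]
    constructor <;> nlinarith [sq_nonneg (v 0 + v 1), sq_nonneg (v 0 - v 1)]
  calc |p * v 0 ^ 2 + q * v 0 * v 1 + r * v 1 ^ 2|
      ≤ |p * v 0 ^ 2| + |q * v 0 * v 1| + |r * v 1 ^ 2| := abs_add_three _ _ _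
    _ = |p| * v 0 ^ 2 + |q| * |v 0 * v 1| + |r| * v 1 ^ 2 := by
        rw [abs_mul, abs_mul r, mul_assoc q, abs_mul q, abs_of_nonneg (sq_nonneg (v 0)),
          abs_of_nonneg (sq_nonneg (v 1))]
    _ ≤ |p| * nsq v + |q| * nsq v + |r| * nsq v := by gcongr
    _ = _ := by ring

theorem abs_form_sub_le (T T' : Matrix (Fin 2) (Fin 2) ℝ) (v : Fin 2 → ℝ) :
    |form T v - form T' v| ≤ entryDist T T' * nsq v := by
  have := abs_le_quad v (-(T 1 0 - T' 1 0)) ((T 0 0 - T' 0 0) - (T 1 1 - T' 1 1))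
    (T 0 1 - T' 0 1)
  have h2 := abs_sub (T 0 0 - T' 0 0) (T 1 1 - T' 1 1)
  rw [abs_neg] at this
  have e : form T v - form T' v = -(T 1 0 - T' 1 0) * v 0 ^ 2 +
      ((T 0 0 - T' 0 0) - (T 1 1 - T' 1 1)) * v 0 * v 1 + (T 0 1 - T' 0 1) * v 1 ^ 2 := by
    simp only [form]; ring
  rw [e]
  refine this.trans (mul_le_mul_of_nonneg_right ?_ (nsq_nonneg v))
  unfold entryDist
  linarith

theorem abs_kickForm_sub_le (T T' : Matrix (Fin 2) (Fin 2) ℝ) (v : Fin 2 → ℝ) :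
    |kickForm T v - kickForm T' v| ≤ 2 * entryDist T T' * nsq v := by
  have := abs_le_quad v ((T 0 0 - T' 0 0) - (T 1 1 - T' 1 1)) (2 * (T 0 1 - T' 0 1)) 0
  have h2 := abs_sub (T 0 0 - T' 0 0) (T 1 1 - T' 1 1)
  rw [abs_mul, abs_two, abs_zero] at this
  have e : kickForm T v - kickForm T' v = ((T 0 0 - T' 0 0) - (T 1 1 - T' 1 1)) * v 0 ^ 2 +
      2 * (T 0 1 - T' 0 1) * v 0 * v 1 + 0 * v 1 ^ 2 := by
    simp only [kickForm]; ring
  rw [e]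
  refine this.trans (mul_le_mul_of_nonneg_right ?_ (nsq_nonneg v))
  unfold entryDist
  linarith [abs_nonneg (T 1 0 - T' 1 0), abs_nonneg (T 0 0 - T' 0 0), abs_nonneg (T 1 1 - T' 1 1)]

/-- Positivity constant of the limiting form. -/
noncomputable def limBound (φ : ℝ) : ℝ := (1 - |Real.cos φ|) / 3

theorem abs_cos_lt_one {φ : ℝ} (hφ : φ ∈ Set.Ioo 0 Real.pi) : |Real.cos φ| < 1 := by
  have h := Real.sin_pos_of_mem_Ioo hφ
  have h2 := Real.sin_sq_add_cos_sq φ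
  rw [abs_lt]
  constructor <;> nlinarith

theorem limBound_pos {φ : ℝ} (hφ : φ ∈ Set.Ioo 0 Real.pi) : 0 < limBound φ := by
  have := abs_cos_lt_one hφ
  unfold limBound
  linarith

/-- With `x = v 0` and `y = v 0 - v 1` the form is `x² + y² - 2xy cos φ`, at least `(1 - |cos φ|)(x²
+ y²)`; the `3` in `limBound` comes from `nsq v ≤ 3 (x² + y²)`. -/
theorem limBound_mul_nsq_le (φ : ℝ) (v : Fin 2 → ℝ) :
    limBound φ * nsq v ≤ form (limMat φ) v := by
  have h1 := neg_abs_le (Real.cos φ)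
  have h2 := le_abs_self (Real.cos φ)
  have h3 := Real.abs_cos_le_one φ
  have e : form (limMat φ) v = v 0 ^ 2 + (v 0 - v 1) ^ 2 -
      2 * (v 0 * (v 0 - v 1)) * Real.cos φ := by
    simp only [form, limMat]
    simp
    ring
  have h4 : 2 * (v 0 * (v 0 - v 1)) * Real.cos φ ≤
      |Real.cos φ| * (v 0 ^ 2 + (v 0 - v 1) ^ 2) := by
    rcases le_total 0 (v 0 * (v 0 - v 1)) with h | h
    · nlinarith [sq_nonneg (v 0 - (v 0 - v 1)), abs_nonneg (Real.cos φ)]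
    · nlinarith [sq_nonneg (v 0 + (v 0 - v 1)), abs_nonneg (Real.cos φ)]
  have h5 : nsq v ≤ 3 * (v 0 ^ 2 + (v 0 - v 1) ^ 2) := by
    unfold nsq
    nlinarith [sq_nonneg (2 * v 0 - v 1), sq_nonneg (v 0 - v 1), sq_nonneg (v 0 + (v 0 - v 1))]
  have h6 : limBound φ * nsq v ≤ limBound φ * (3 * (v 0 ^ 2 + (v 0 - v 1) ^ 2)) :=
    mul_le_mul_of_nonneg_left h5 (by unfold limBound; linarith)
  rw [e]
  unfold limBound at h6 ⊢
  linarith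

/-- Logarithms of comparable positive numbers. -/
theorem abs_log_sub_log_le {x y c : ℝ} (hc : 0 < c) (hx : c ≤ x) (hy : c ≤ y) :
    |Real.log x - Real.log y| ≤ |x - y| / c := by
  have key : ∀ {x y : ℝ}, c ≤ x → c ≤ y → Real.log x - Real.log y ≤ |x - y| / c := by
    intro x y hx hy
    have hx0 := hc.trans_le hx
    have hy0 := hc.trans_le hy
    rw [← Real.log_div hx0.ne' hy0.ne']
    calc Real.log (x / y) ≤ x / y - 1 := Real.log_le_sub_one_of_pos (by positivity)
      _ = (x - y) / y := by field_simp
      _ ≤ |x - y| / y := by gcongr; exact le_abs_self _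
      _ ≤ |x - y| / c := by gcongr
  rw [abs_le]
  have h1 := key hx hy
  have h2 := key hy hx
  rw [abs_sub_comm] at h2
  constructor <;> linarith

/-- Both forms scale like `nsq v`, which cancels: the bound does not depend on the vector, so it can
be summed along any orbit. -/
theorem abs_log_form_sub_le {T T' : Matrix (Fin 2) (Fin 2) ℝ} {κ : ℝ} (hκ : 0 < κ)
    {v : Fin 2 → ℝ} (hv : v ≠ 0) (h : κ * nsq v ≤ form T v) (h' : κ * nsq v ≤ form T' v) :
    |Real.log (form T v) - Real.log (form T' v)| ≤ entryDist T T' / κ := by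
  have hn := nsq_pos hv
  refine (abs_log_sub_log_le (mul_pos hκ hn) h h').trans ?_
  rw [div_le_div_iff₀ (by positivity) hκ]
  have := abs_form_sub_le T T' v
  nlinarith

/-- The coefficient is homogeneous of degree zero, so positivity of the form bounds it uniformly in
`v`, and later uniformly in `ω`. -/
theorem abs_linCoef_le {T : Matrix (Fin 2) (Fin 2) ℝ} {κ : ℝ} (hκ : 0 < κ) {v : Fin 2 → ℝ}
    (hv : v ≠ 0) (h : κ * nsq v ≤ form T v) : |linCoef T v| ≤ 2 * entryDist T 0 / κ := by
  have hn := nsq_pos hv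
  have hf : 0 < form T v := (mul_pos hκ hn).trans_le h
  have := abs_kickForm_sub_le T 0 v
  rw [show kickForm 0 v = 0 by simp [kickForm], sub_zero] at this
  have h0 : 0 ≤ entryDist T 0 := by unfold entryDist; positivity
  rw [linCoef, abs_div, abs_of_pos hf, div_le_div_iff₀ hf hκ]
  calc |kickForm T v| * κ ≤ 2 * entryDist T 0 * nsq v * κ := by gcongr
    _ = 2 * entryDist T 0 * (κ * nsq v) := by ring
    _ ≤ _ := by gcongr

theorem abs_sq_coef_le {T : Matrix (Fin 2) (Fin 2) ℝ} {κ : ℝ} (hκ : 0 < κ) {v : Fin 2 → ℝ}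
    (hv : v ≠ 0) (h : κ * nsq v ≤ form T v) :
    |T 0 1 * v 0 ^ 2 / form T v| ≤ entryDist T 0 / κ := by
  have hn := nsq_pos hv
  have hf : 0 < form T v := (mul_pos hκ hn).trans_le h
  have h0 : |T 0 1| ≤ entryDist T 0 := by
    unfold entryDist
    simp only [Matrix.zero_apply, sub_zero]
    linarith [abs_nonneg (T 0 0), abs_nonneg (T 1 0), abs_nonneg (T 1 1)]
  have h1 : v 0 ^ 2 ≤ nsq v := by unfold nsq; nlinarith [sq_nonneg (v 1)]
  have h2 := (abs_nonneg _).trans h0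
  rw [abs_div, abs_of_pos hf, div_le_div_iff₀ hf hκ, abs_mul, abs_of_nonneg (sq_nonneg (v 0))]
  calc |T 0 1| * v 0 ^ 2 * κ ≤ entryDist T 0 * nsq v * κ := by gcongr
    _ = entryDist T 0 * (κ * nsq v) := by ring
    _ ≤ _ := by gcongr

/-- Second order expansion of the logarithm. -/
theorem abs_log_one_add_sub_le {γ ξ η K : ℝ} (hK : 1 ≤ K) (hξ : |ξ| ≤ K) (hη : |η| ≤ K)
    (hγ : |γ| ≤ 1 / (4 * K)) :
    |Real.log (1 + γ * ξ + γ ^ 2 * η) - (γ * ξ + γ ^ 2 * (η - ξ ^ 2 / 2))| ≤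
      20 * K ^ 3 * |γ| ^ 3 := by
  have hK0 : 0 < K := by linarith
  have hg0 := abs_nonneg γ
  have hγK : |γ| * K ≤ 1 / 4 := by
    calc |γ| * K ≤ 1 / (4 * K) * K := by gcongr
      _ = 1 / 4 := by field_simp
  have hγ1 : |γ| ≤ 1 := by nlinarith
  set X := γ * ξ + γ ^ 2 * η with hX
  have hX1 : |X| ≤ 2 * (|γ| * K) := by
    calc |X| ≤ |γ * ξ| + |γ ^ 2 * η| := abs_add_le _ _
      _ = |γ| * |ξ| + |γ| * |γ| * |η| := by rw [abs_mul, abs_mul, abs_pow, sq]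
      _ ≤ |γ| * K + |γ| * 1 * K := by gcongr
      _ = _ := by ring
  have hX2 : |X| ≤ 1 / 2 := by linarith
  have hlog := Real.abs_log_sub_add_sum_range_le (x := -X) (by rw [abs_neg]; linarith) 2
  rw [abs_neg, sub_neg_eq_add] at hlog
  simp only [Finset.sum_range_succ, Finset.sum_range_zero] at hlog
  -- The cube of `2 |γ| K` gives `8`, and `1 - |X| ≥ 1/2` doubles it. With the two leftover terms of
  -- `X²/2`, each at most `K³ |γ|³`, the total stays below `20`.
  have hb1 : |X| ^ (2 + 1) / (1 - |X|) ≤ 16 * (K ^ 3 * |γ| ^ 3) := by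
    have : |X| ^ (2 + 1) ≤ (2 * (|γ| * K)) ^ 3 := by gcongr
    rw [div_le_iff₀ (by linarith)]
    have h0 : 0 ≤ K ^ 3 * |γ| ^ 3 := by positivity
    nlinarith
  have hb2 : |γ ^ 3 * ξ * η| ≤ K ^ 3 * |γ| ^ 3 := by
    rw [abs_mul, abs_mul, abs_pow]
    calc |γ| ^ 3 * |ξ| * |η| ≤ |γ| ^ 3 * K * K := by gcongr
      _ ≤ |γ| ^ 3 * K * K * K := le_mul_of_one_le_right (by positivity) hK
      _ = _ := by ring
  have hb3 : |γ ^ 4 * η ^ 2 / 2| ≤ K ^ 3 * |γ| ^ 3 := by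
    rw [abs_div, abs_mul, abs_pow, abs_pow, abs_two]
    calc |γ| ^ 4 * |η| ^ 2 / 2 ≤ |γ| ^ 4 * K ^ 2 / 2 := by gcongr
      _ = |γ| ^ 3 * K * (|γ| * K) / 2 := by ring
      _ ≤ |γ| ^ 3 * K * (1 / 4) / 2 := by gcongr
      _ ≤ |γ| ^ 3 * K := by
        have : 0 ≤ |γ| ^ 3 * K := by positivity
        linarith
      _ ≤ |γ| ^ 3 * K * K * K := by
        have : |γ| ^ 3 * K ≤ |γ| ^ 3 * K * K := le_mul_of_one_le_right (by positivity) hK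
        exact this.trans (le_mul_of_one_le_right (by positivity) hK)
      _ = _ := by ring
  have e : Real.log (1 + γ * ξ + γ ^ 2 * η) - (γ * ξ + γ ^ 2 * (η - ξ ^ 2 / 2)) =
      (0 + (-X) ^ (0 + 1) / ((0 : ℕ) + 1) + (-X) ^ (1 + 1) / ((1 : ℕ) + 1) + Real.log (1 + X)) -
        γ ^ 3 * ξ * η - γ ^ 4 * η ^ 2 / 2 := by
    rw [show 1 + γ * ξ + γ ^ 2 * η = 1 + X by rw [hX]; ring]
    push_cast
    rw [hX]
    ring
  rw [e]
  have t1 := abs_sub (0 + (-X) ^ (0 + 1) / (((0 : ℕ) : ℝ) + 1) + (-X) ^ (1 + 1) / ((1 : ℕ) + 1) +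
    Real.log (1 + X)) (γ ^ 3 * ξ * η)
  have t2 := abs_sub (0 + (-X) ^ (0 + 1) / (((0 : ℕ) : ℝ) + 1) + (-X) ^ (1 + 1) / ((1 : ℕ) + 1) +
    Real.log (1 + X) - γ ^ 3 * ξ * η) (γ ^ 4 * η ^ 2 / 2)
  have h0 : 0 ≤ K ^ 3 * |γ| ^ 3 := by positivity
  nlinarith

theorem mulVec_ne_zero_of_det_eq_one {T : Matrix (Fin 2) (Fin 2) ℝ} (hT : T.det = 1)
    {v : Fin 2 → ℝ} (hv : v ≠ 0) : T.mulVec v ≠ 0 := by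
  intro h
  have hu : IsUnit T := (Matrix.isUnit_iff_isUnit_det T).2 (by rw [hT]; exact isUnit_one)
  exact hv ((Matrix.mulVec_injective_iff_isUnit.2 hu) (by rw [h, Matrix.mulVec_zero]))

/-! ### The logarithm of the form along an orbit. -/

section Path

variable {T : ℕ → Matrix (Fin 2) (Fin 2) ℝ} {h : ℕ → ℝ} {v : ℕ → Fin 2 → ℝ}

theorem orbit_ne_zero (hdet : ∀ n, (T n).det = 1)
    (hv : ∀ n, v (n + 1) = (kickMat (h n) * T n).mulVec (v n)) (hv0 : v 0 ≠ 0) (n : ℕ) :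
    v n ≠ 0 := by
  induction n with
  | zero => exact hv0
  | succ n ih =>
    rw [hv]
    exact mulVec_ne_zero_of_det_eq_one (by rw [Matrix.det_mul, det_kickMat, hdet, one_mul]) ih

theorem tendsto_zero_of_summable_cube (hh : Summable fun n => |h n| ^ 3) :
    Tendsto h atTop (𝓝 0) := by
  have := hh.tendsto_atTop_zero
  rw [Metric.tendsto_atTop] at this ⊢
  intro ε hε
  obtain ⟨N, hN⟩ := this (ε ^ 3) (by positivity)
  refine ⟨N, fun n hn => ?_⟩
  have := hN n hn
  rw [Real.dist_0_eq_abs, abs_of_nonneg (by positivity)] at this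
  rw [Real.dist_0_eq_abs]
  exact lt_of_pow_lt_pow_left₀ 3 hε.le this

/-- Up to a summable error, the logarithm of the adapted form along an orbit is a sum of a linear
and a quadratic term in the couplings. -/
theorem exists_summable_log_form (hdet : ∀ n, (T n).det = 1)
    (hv : ∀ n, v (n + 1) = (kickMat (h n) * T n).mulVec (v n)) (hv0 : v 0 ≠ 0)
    {κ B : ℝ} (hκ : 0 < κ) {N : ℕ} (hlow : ∀ n ≥ N, ∀ x, κ * nsq x ≤ form (T n) x)
    (hB : ∀ n, entryDist (T n) 0 ≤ B) (hsum : Summable fun n => entryDist (T (n + 1)) (T n))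
    (hh : Summable fun n => |h n| ^ 3) :
    ∃ e : ℕ → ℝ, Summable e ∧ ∀ n, Real.log (form (T n) (v n)) - Real.log (form (T 0) (v 0)) =
      ∑ j ∈ Finset.range n, ((if N ≤ j then h j * linCoef (T j) ((T j).mulVec (v j)) +
        h j ^ 2 * quadCoef (T j) ((T j).mulVec (v j)) else 0) + e j) := by
  -- The error is taken to be the increment minus the main term, so the identity is a telescoping
  -- sum and only summability needs an argument.
  refine ⟨fun j => (Real.log (form (T (j + 1)) (v (j + 1))) - Real.log (form (T j) (v j))) -
    (if N ≤ j then h j * linCoef (T j) ((T j).mulVec (v j)) +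
        h j ^ 2 * quadCoef (T j) ((T j).mulVec (v j)) else 0), ?_, fun n => ?_⟩
  swap
  · simp only [add_sub_cancel]
    rw [Finset.sum_range_sub (fun j => Real.log (form (T j) (v j)))]
  have hne := orbit_ne_zero hdet hv hv0
  set K : ℝ := 2 * B / κ + 1 with hK
  have hB0 : 0 ≤ B := le_trans (by unfold entryDist; positivity) (hB 0)
  have hK1 : 1 ≤ K := by rw [hK]; linarith [show 0 ≤ 2 * B / κ by positivity]
  have hsmall : ∀ᶠ n in atTop, |h n| < 1 / (4 * K) := by
    have := (tendsto_zero_of_summable_cube hh).abs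
    rw [abs_zero] at this
    exact this.eventually (gt_mem_nhds (by positivity))
  refine Summable.of_norm_bounded_eventually_nat
    ((hh.mul_left (20 * K ^ 3)).add (hsum.mul_right κ⁻¹)) ?_
  filter_upwards [hsmall, eventually_ge_atTop N] with n hn hNn
  set w := (T n).mulVec (v n) with hw
  have hwne : w ≠ 0 := mulVec_ne_zero_of_det_eq_one (hdet n) (hne n)
  have hwf : 0 < form (T n) w := (mul_pos hκ (nsq_pos hwne)).trans_le (hlow n hNn w)
  have hξ : |linCoef (T n) w| ≤ K := by
    refine (abs_linCoef_le hκ hwne (hlow n hNn w)).trans ?_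
    have : 2 * entryDist (T n) 0 / κ ≤ 2 * B / κ := by gcongr; exact hB n
    linarith
  have hη : |T n 0 1 * w 0 ^ 2 / form (T n) w| ≤ K := by
    refine (abs_sq_coef_le hκ hwne (hlow n hNn w)).trans ?_
    have h1 : entryDist (T n) 0 / κ ≤ B / κ := by gcongr; exact hB n
    have h2 : 2 * B / κ = B / κ + B / κ := by ring
    have h3 : 0 ≤ B / κ := by positivity
    linarith
  have hlog := abs_log_one_add_sub_le hK1 hξ hη hn.le
  have hvn : v (n + 1) = (kickMat (h n)).mulVec w := by
    rw [hv, hw, Matrix.mulVec_mulVec]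
  have hpos : 0 < form (T n) (v (n + 1)) :=
    (mul_pos hκ (nsq_pos (hne _))).trans_le (hlow n hNn _)
  have hform : form (T n) (v (n + 1)) = form (T n) (v n) *
      (1 + h n * linCoef (T n) w + h n ^ 2 * (T n 0 1 * w 0 ^ 2 / form (T n) w)) := by
    rw [← form_mulVec (hdet n) (v n), ← hw, hvn, form_kickMat, linCoef]
    field_simp
  have hvf : 0 < form (T n) (v n) := by rwa [← form_mulVec (hdet n) (v n), ← hw]
  have hfac : 0 < 1 + h n * linCoef (T n) w + h n ^ 2 * (T n 0 1 * w 0 ^ 2 / form (T n) w) := by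
    rw [hform] at hpos
    exact pos_of_mul_pos_right hpos hvf.le
  -- The increment splits at `form (T n) (v (n + 1))`: changing the matrix at a fixed vector costs
  -- `entryDist`, while the kick at a fixed matrix is the expanded logarithm in `hlog`.
  have hd := abs_log_form_sub_le hκ (hne (n + 1)) (hlow (n + 1) (by omega) (v (n + 1)))
    (hlow n hNn _)
  rw [hform, Real.log_mul hvf.ne' hfac.ne'] at hd
  rw [if_pos hNn, Real.norm_eq_abs]
  rw [div_eq_mul_inv] at hd
  rw [quadCoef]
  refine le_trans ?_ (add_le_add hlog hd)
  refine le_trans (le_of_eq ?_) (abs_add_le _ _)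
  congr 1
  ring_nf

end Path

/-! ### The Prüfer coordinate and its phase. -/

/-- The coordinate of a real vector along the eigenvector `f_+`. -/
noncomputable def pruferCoord (φ : ℝ) (v : Fin 2 → ℝ) : ℂ :=
  ⟨v 0 / 2, (v 0 - v 1 - v 0 * Real.cos φ) / (2 * Real.sin φ)⟩

/-- The squared direction `e^{2iψ}` of the Prüfer coordinate. -/
noncomputable def pruferPhase (φ : ℝ) (v : Fin 2 → ℝ) : ℂ :=
  pruferCoord φ v / (starRingEnd ℂ) (pruferCoord φ v)

theorem normSq_pruferCoord {φ : ℝ} (hs : Real.sin φ ≠ 0) (v : Fin 2 → ℝ) :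
    Complex.normSq (pruferCoord φ v) = form (limMat φ) v / (4 * Real.sin φ ^ 2) := by
  have := Real.sin_sq_add_cos_sq φ
  simp only [pruferCoord, Complex.normSq_mk, form, limMat]
  simp
  field_simp
  linear_combination 4 * v 0 ^ 2 * this

theorem exp_I_mul_eq (t : ℝ) : Complex.exp (Complex.I * t) = ⟨Real.cos t, Real.sin t⟩ := by
  rw [mul_comm Complex.I]
  exact Complex.ext (Complex.exp_ofReal_mul_I_re t) (Complex.exp_ofReal_mul_I_im t)

/-- The vector `fPlus φ` is an eigenvector of the limiting matrix for `e^{iφ}`, so the phase turns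
by exactly `e^{2iφ}`. -/
theorem pruferCoord_limMat {φ : ℝ} (hs : Real.sin φ ≠ 0) (v : Fin 2 → ℝ) :
    pruferCoord φ ((limMat φ).mulVec v) = Complex.exp (Complex.I * φ) * pruferCoord φ v := by
  have := Real.sin_sq_add_cos_sq φ
  rw [exp_I_mul_eq]
  apply Complex.ext
  · simp [pruferCoord, mulVec_zero', mulVec_one', limMat]
    field_simp
    ring
  · simp [pruferCoord, mulVec_zero', mulVec_one', limMat]
    field_simp
    linear_combination (-v 0) * this

theorem pruferCoord_sub (φ : ℝ) (v w : Fin 2 → ℝ) :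
    pruferCoord φ (v - w) = pruferCoord φ v - pruferCoord φ w := by
  apply Complex.ext
  · simp [pruferCoord]; ring
  · simp [pruferCoord]; ring

theorem pruferCoord_smul (φ r : ℝ) (v : Fin 2 → ℝ) :
    pruferCoord φ (r • v) = r * pruferCoord φ v := by
  apply Complex.ext
  · simp [pruferCoord]; ring
  · simp [pruferCoord]; ring

theorem pruferPhase_smul {φ r : ℝ} (hr : r ≠ 0) (v : Fin 2 → ℝ) :
    pruferPhase φ (r • v) = pruferPhase φ v := by
  rw [pruferPhase, pruferCoord_smul, map_mul, Complex.conj_ofReal, mul_div_mul_left,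
    pruferPhase]
  exact_mod_cast hr

theorem pruferCoord_ne_zero {φ : ℝ} (hφ : φ ∈ Set.Ioo 0 Real.pi) {v : Fin 2 → ℝ} (hv : v ≠ 0) :
    pruferCoord φ v ≠ 0 := by
  have hs := Real.sin_pos_of_mem_Ioo hφ
  rw [← Complex.normSq_pos, normSq_pruferCoord hs.ne']
  have := limBound_mul_nsq_le φ v
  have := mul_pos (limBound_pos hφ) (nsq_pos hv)
  have : 0 < form (limMat φ) v := by linarith
  positivity

theorem norm_pruferPhase {φ : ℝ} (hφ : φ ∈ Set.Ioo 0 Real.pi) {v : Fin 2 → ℝ} (hv : v ≠ 0) :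
    ‖pruferPhase φ v‖ = 1 := by
  rw [pruferPhase, norm_div, Complex.norm_conj, div_self]
  exact norm_ne_zero_iff.2 (pruferCoord_ne_zero hφ hv)

/-- The quadratic coefficient for the limiting matrix, as a trigonometric polynomial in the
phase. -/
theorem quadCoef_limMat {φ : ℝ} (hφ : φ ∈ Set.Ioo 0 Real.pi) {v : Fin 2 → ℝ} (hv : v ≠ 0) :
    quadCoef (limMat φ) v = (Real.sin φ ^ 2)⁻¹ *
      (1 / 4 + (pruferPhase φ v).re / 2 + (pruferPhase φ v ^ 2).re / 4) := by
  have hs := Real.sin_pos_of_mem_Ioo hφ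
  have hf := normSq_pruferCoord hs.ne' v
  have hp := Complex.normSq_pos.2 (pruferCoord_ne_zero hφ hv)
  -- Expressing `v` by the real and imaginary parts of its coordinate makes the form a multiple of
  -- `X² + Y²` and `kickForm` a multiple of `XY`, so the claim becomes a rational identity.
  obtain ⟨X, hX⟩ : ∃ X, X = (pruferCoord φ v).re := ⟨_, rfl⟩
  obtain ⟨Y, hY⟩ : ∃ Y, Y = (pruferCoord φ v).im := ⟨_, rfl⟩
  have hXY : pruferCoord φ v = ⟨X, Y⟩ := by rw [hX, hY]
  have h0 : v 0 = 2 * X := by rw [hX]; simp only [pruferCoord]; ring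
  have h1 : v 1 = 2 * X - 2 * X * Real.cos φ - 2 * Y * Real.sin φ := by
    rw [hX, hY]; simp only [pruferCoord]; field_simp; ring
  rw [hXY, Complex.normSq_mk] at hf hp
  have hform : form (limMat φ) v = 4 * Real.sin φ ^ 2 * (X * X + Y * Y) := by
    rw [hf]; field_simp
  have hkick : kickForm (limMat φ) v = -(8 * X * Y * Real.sin φ) := by
    simp only [kickForm, limMat, h0, h1]
    simp
    ring
  have hq : pruferPhase φ v = ⟨(X ^ 2 - Y ^ 2) / (X * X + Y * Y), 2 * X * Y / (X * X + Y * Y)⟩ := by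
    rw [pruferPhase, hXY]
    apply Complex.ext
    · simp [Complex.div_re, Complex.normSq_mk]; ring
    · simp [Complex.div_im, Complex.normSq_mk]; ring
  have h01 : limMat φ 0 1 = 1 := by simp [limMat]
  have hne : X ^ 2 + Y ^ 2 ≠ 0 := by nlinarith
  rw [quadCoef, linCoef, hform, hkick, hq, h0, h01, sq (Complex.mk _ _)]
  simp only [Complex.mul_re]
  field_simp
  ring

/-! ### Logarithmic averages. -/

/-- The harmonic sums `∑_{j=1}^n 1/j`. -/
noncomputable def harm (n : ℕ) : ℝ := ∑ j ∈ Finset.range n, 1 / ((j : ℝ) + 1)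

theorem harm_tendsto : Tendsto harm atTop atTop := Real.tendsto_sum_range_one_div_nat_succ_atTop

theorem isLittleO_harm_of_bounded {E : Type*} [NormedAddCommGroup E] {f : ℕ → E} {K : ℝ}
    (hf : ∀ n, ‖f n‖ ≤ K) : f =o[atTop] harm := by
  have h1 : f =O[atTop] fun _ => (1 : ℝ) :=
    Asymptotics.IsBigO.of_bound K (Eventually.of_forall fun n => by simpa using hf n)
  refine h1.trans_isLittleO ?_
  rw [Asymptotics.isLittleO_const_left]
  right
  exact tendsto_norm_atTop_atTop.comp harm_tendsto

theorem isLittleO_sum_harm {f : ℕ → ℂ} (hf : Tendsto f atTop (𝓝 0)) :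
    (fun n => ∑ j ∈ Finset.range n, f j * (1 / ((j : ℝ) + 1) : ℝ)) =o[atTop] harm := by
  refine Asymptotics.IsLittleO.sum_range (g := fun j : ℕ => 1 / ((j : ℝ) + 1)) ?_
    (fun j => by positivity) harm_tendsto
  have h1 : (fun j : ℕ => ((1 / ((j : ℝ) + 1) : ℝ) : ℂ)) =O[atTop] fun j : ℕ => 1 / ((j : ℝ) + 1) :=
    Asymptotics.IsBigO.of_bound 1 (Eventually.of_forall fun n => by
      rw [Complex.norm_real, one_mul])
  simpa using ((Asymptotics.isLittleO_one_iff ℝ).2 hf).mul_isBigO h1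

/-- Logarithmic averages of an asymptotically rotating bounded sequence vanish. -/
theorem isLittleO_sum_rotating {z : ℕ → ℂ} {c : ℂ} (hz : ∀ n, ‖z n‖ ≤ 1) (hc : c ≠ 1)
    (h : Tendsto (fun n => z (n + 1) - c * z n) atTop (𝓝 0)) :
    (fun n => ∑ j ∈ Finset.range n, z j * (1 / ((j : ℝ) + 1) : ℝ)) =o[atTop] harm := by
  have hb := isLittleO_sum_harm h
  have hr : Tendsto (fun n : ℕ => z (n + 1) * ((1 / ((n : ℝ) + 2) : ℝ) : ℂ)) atTop (𝓝 0) := by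
    refine squeeze_zero_norm (a := fun n : ℕ => 1 / ((n : ℝ) + 1)) (fun n => ?_)
      tendsto_one_div_add_atTop_nhds_zero_nat
    rw [norm_mul, Complex.norm_real, Real.norm_of_nonneg (by positivity)]
    calc ‖z (n + 1)‖ * (1 / ((n : ℝ) + 2)) ≤ 1 * (1 / ((n : ℝ) + 1)) := by
          gcongr
          · exact hz _
          · norm_num
      _ = _ := one_mul _
  have hr' := isLittleO_sum_harm hr
  have htel : (fun n : ℕ => z 0 - z n * (1 / ((n : ℝ) + 1) : ℝ)) =o[atTop] harm := by
    refine isLittleO_harm_of_bounded (K := 2) fun n => (norm_sub_le _ _).trans ?_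
    rw [norm_mul, Complex.norm_real, Real.norm_of_nonneg (by positivity)]
    have : 1 / ((n : ℝ) + 1) ≤ 1 := by
      rw [div_le_one (by positivity)]; linarith [show (0 : ℝ) ≤ n by positivity]
    have := mul_le_mul (hz n) this (by positivity) zero_le_one
    linarith [hz 0]
  -- Summation by parts: `1 - c` times the sum is a bounded boundary term, the rotation defect, and
  -- a term with the weight difference `1/(j+1) - 1/(j+2)`, which is `1/(j+2)` times the weight
  -- `1/(j+1)`.
  have e : (fun n => ∑ j ∈ Finset.range n, z j * (1 / ((j : ℝ) + 1) : ℝ)) = fun n : ℕ =>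
      (1 - c)⁻¹ * ((z 0 - z n * (1 / ((n : ℝ) + 1) : ℝ)) +
        ∑ j ∈ Finset.range n, (z (j + 1) - c * z j) * (1 / ((j : ℝ) + 1) : ℝ) -
        ∑ j ∈ Finset.range n, z (j + 1) * ((1 / ((j : ℝ) + 2) : ℝ) : ℂ) *
          (1 / ((j : ℝ) + 1) : ℝ)) := by
    funext n
    have hc' : 1 - c ≠ 0 := sub_ne_zero.2 hc.symm
    rw [eq_inv_mul_iff_mul_eq₀ hc']
    induction n with
    | zero => simp
    | succ n ih =>
      rw [Finset.sum_range_succ, Finset.sum_range_succ, Finset.sum_range_succ, mul_add, ih]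
      have h1 : ((n : ℂ) + 1) ≠ 0 := by exact_mod_cast n.succ_ne_zero
      have h2 : ((n : ℂ) + 2) ≠ 0 := by exact_mod_cast (n + 1).succ_ne_zero
      push_cast
      rw [show (n : ℂ) + 1 + 1 = n + 2 by ring]
      field_simp
      ring
  rw [e]
  exact ((htel.add hb).sub hr').const_mul_left _

/-- The numerator of the difference carries a factor of modulus `‖x‖` that cancels one in the
denominator, so only `y` needs a lower bound. -/
theorem norm_phase_sub_le {x y : ℂ} (hx : x ≠ 0) (hy : y ≠ 0) :
    ‖x / (starRingEnd ℂ) x - y / (starRingEnd ℂ) y‖ ≤ 2 * ‖x - y‖ / ‖y‖ := by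
  have hx' : (starRingEnd ℂ) x ≠ 0 := (map_ne_zero _).2 hx
  have hy' : (starRingEnd ℂ) y ≠ 0 := (map_ne_zero _).2 hy
  have e : x / (starRingEnd ℂ) x - y / (starRingEnd ℂ) y =
      ((x - y) * (starRingEnd ℂ) x - x * (starRingEnd ℂ) (x - y)) /
        ((starRingEnd ℂ) x * (starRingEnd ℂ) y) := by
    rw [map_sub]; field_simp; ring
  rw [e, norm_div, norm_mul, Complex.norm_conj, Complex.norm_conj,
    div_le_div_iff₀ (by positivity) (by positivity)]
  have := norm_sub_le ((x - y) * (starRingEnd ℂ) x) (x * (starRingEnd ℂ) (x - y))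
  rw [norm_mul, norm_mul, Complex.norm_conj, Complex.norm_conj] at this
  calc _ ≤ (‖x - y‖ * ‖x‖ + ‖x‖ * ‖x - y‖) * ‖y‖ := by gcongr
    _ = _ := by ring

/-! ### Perturbation of the phase rotation. -/

/-- The unit vector in the direction of `v`. -/
noncomputable def dir (v : Fin 2 → ℝ) : Fin 2 → ℝ := (√(nsq v))⁻¹ • v

theorem nsq_dir {v : Fin 2 → ℝ} (hv : v ≠ 0) : nsq (dir v) = 1 := by
  have h := nsq_pos hv
  have h2 := Real.sq_sqrt h.le
  have h3 := (Real.sqrt_pos.2 h).ne'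
  have : nsq (dir v) = (√(nsq v))⁻¹ ^ 2 * nsq v := by
    simp [dir, nsq]; ring
  rw [this, inv_pow, h2]
  field_simp

theorem dir_ne_zero {v : Fin 2 → ℝ} (hv : v ≠ 0) : dir v ≠ 0 := by
  intro h
  have := nsq_dir hv
  simp [h, nsq] at this

theorem pruferPhase_dir (φ : ℝ) {v : Fin 2 → ℝ} (hv : v ≠ 0) :
    pruferPhase φ (dir v) = pruferPhase φ v :=
  pruferPhase_smul (inv_ne_zero (Real.sqrt_pos.2 (nsq_pos hv)).ne') v

theorem quadCoef_smul (T : Matrix (Fin 2) (Fin 2) ℝ) {r : ℝ} (hr : r ≠ 0) (v : Fin 2 → ℝ) :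
    quadCoef T (r • v) = quadCoef T v := by
  have h1 : form T (r • v) = r ^ 2 * form T v := by simp [form]; ring
  have h2 : kickForm T (r • v) = r ^ 2 * kickForm T v := by simp [kickForm]; ring
  have h3 : T 0 1 * (r • v) 0 ^ 2 = r ^ 2 * (T 0 1 * v 0 ^ 2) := by simp; ring
  have hr2 : r ^ 2 ≠ 0 := pow_ne_zero 2 hr
  rw [quadCoef, linCoef, h1, h2, h3, mul_div_mul_left _ _ hr2, mul_div_mul_left _ _ hr2, quadCoef,
    linCoef]

theorem quadCoef_dir (T : Matrix (Fin 2) (Fin 2) ℝ) {v : Fin 2 → ℝ} (hv : v ≠ 0) :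
    quadCoef T (dir v) = quadCoef T v :=
  quadCoef_smul T (inv_ne_zero (Real.sqrt_pos.2 (nsq_pos hv)).ne') v

theorem abs_apply_le_one {v : Fin 2 → ℝ} (hv : nsq v = 1) : |v 0| ≤ 1 ∧ |v 1| ≤ 1 := by
  unfold nsq at hv
  constructor <;>
  · rw [← sq_le_one_iff_abs_le_one]
    nlinarith [sq_nonneg (v 0), sq_nonneg (v 1)]

theorem norm_pruferCoord_le {φ ε : ℝ} (hs : 0 < Real.sin φ) {v : Fin 2 → ℝ} (h0 : |v 0| ≤ ε)
    (h1 : |v 1| ≤ ε) : ‖pruferCoord φ v‖ ≤ (1 / 2 + 3 / (2 * Real.sin φ)) * ε := by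
  have hε := (abs_nonneg _).trans h0
  refine (Complex.norm_le_abs_re_add_abs_im _).trans ?_
  have e1 : |(pruferCoord φ v).re| ≤ ε / 2 := by
    simp only [pruferCoord]
    rw [abs_div, abs_two]
    gcongr
  have e2 : |(pruferCoord φ v).im| ≤ 3 * ε / (2 * Real.sin φ) := by
    simp only [pruferCoord]
    rw [abs_div, abs_of_pos (by positivity : 0 < 2 * Real.sin φ)]
    gcongr
    have a1 := abs_sub (v 0 - v 1) (v 0 * Real.cos φ)
    have a2 := abs_sub (v 0) (v 1)
    have a3 : |v 0 * Real.cos φ| ≤ ε * 1 := by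
      rw [abs_mul]; gcongr; exact Real.abs_cos_le_one φ
    linarith
  calc _ ≤ ε / 2 + 3 * ε / (2 * Real.sin φ) := add_le_add e1 e2
    _ = _ := by ring

theorem abs_mulVec_sub_le (S M : Matrix (Fin 2) (Fin 2) ℝ) {v : Fin 2 → ℝ} (hv : nsq v = 1) :
    |(S.mulVec v - M.mulVec v) 0| ≤ entryDist S M ∧
      |(S.mulVec v - M.mulVec v) 1| ≤ entryDist S M := by
  obtain ⟨h0, h1⟩ := abs_apply_le_one hv
  simp only [Pi.sub_apply, mulVec_zero', mulVec_one', entryDist]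
  have key : ∀ p q p' q' : ℝ,
      |p * v 0 + q * v 1 - (p' * v 0 + q' * v 1)| ≤ |p - p'| + |q - q'| := by
    intro p q p' q'
    calc _ = |(p - p') * v 0 + (q - q') * v 1| := by congr 1; ring
      _ ≤ |(p - p') * v 0| + |(q - q') * v 1| := abs_add_le _ _
      _ = |p - p'| * |v 0| + |q - q'| * |v 1| := by rw [abs_mul, abs_mul]
      _ ≤ |p - p'| * 1 + |q - q'| * 1 := by gcongr
      _ = _ := by ring
  constructor
  · refine (key _ _ _ _).trans ?_
    linarith [abs_nonneg (S 1 0 - M 1 0), abs_nonneg (S 1 1 - M 1 1)]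
  · refine (key _ _ _ _).trans ?_
    linarith [abs_nonneg (S 0 0 - M 0 0), abs_nonneg (S 0 1 - M 0 1)]

/-- The phase depends only on the direction, so `v` may be taken of unit length. Then `limMat φ`
rotates it exactly, and its invariant form bounds the denominator from below. -/
theorem norm_pruferPhase_mulVec_sub_le {φ : ℝ} (hφ : φ ∈ Set.Ioo 0 Real.pi)
    {S : Matrix (Fin 2) (Fin 2) ℝ} (hS : S.det = 1) {v : Fin 2 → ℝ} (hv : v ≠ 0) :
    ‖pruferPhase φ (S.mulVec v) - Complex.exp (2 * (Complex.I * φ)) * pruferPhase φ v‖ ≤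
      2 * ((1 / 2 + 3 / (2 * Real.sin φ)) * entryDist S (limMat φ)) /
        √(limBound φ / (4 * Real.sin φ ^ 2)) := by
  have hs := Real.sin_pos_of_mem_Ioo hφ
  have hd := dir_ne_zero hv
  have hr := inv_ne_zero (Real.sqrt_pos.2 (nsq_pos hv)).ne'
  have e1 : pruferPhase φ (S.mulVec v) = pruferPhase φ (S.mulVec (dir v)) := by
    rw [dir, Matrix.mulVec_smul, pruferPhase_smul hr]
  have e2 : Complex.exp (2 * (Complex.I * φ)) * pruferPhase φ v =
      pruferPhase φ ((limMat φ).mulVec (dir v)) := by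
    rw [← pruferPhase_dir φ hv, pruferPhase, pruferPhase, pruferCoord_limMat hs.ne', map_mul,
      ← Complex.exp_conj, map_mul, Complex.conj_I, Complex.conj_ofReal, neg_mul, Complex.exp_neg,
      two_mul, Complex.exp_add]
    field_simp
  have hlim : (limMat φ).det = 1 := by
    simp [limMat, Matrix.det_fin_two_of]; norm_num
  rw [e1, e2]
  refine (norm_phase_sub_le (pruferCoord_ne_zero hφ (mulVec_ne_zero_of_det_eq_one hS hd))
    (pruferCoord_ne_zero hφ (mulVec_ne_zero_of_det_eq_one hlim hd))).trans ?_
  have hlow := limBound_mul_nsq_le φ (dir v)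
  rw [nsq_dir hv, mul_one] at hlow
  have hb := limBound_pos hφ
  have hE : 0 ≤ entryDist S (limMat φ) := by unfold entryDist; positivity
  gcongr
  · rw [← pruferCoord_sub]
    obtain ⟨a0, a1⟩ := abs_mulVec_sub_le S (limMat φ) (nsq_dir hv)
    exact norm_pruferCoord_le hs a0 a1
  · rw [Real.sqrt_le_left (norm_nonneg _), ← Complex.normSq_eq_norm_sq, normSq_pruferCoord hs.ne',
      form_mulVec hlim]
    gcongr

theorem tendsto_entryDist {S : ℕ → Matrix (Fin 2) (Fin 2) ℝ} {M : Matrix (Fin 2) (Fin 2) ℝ}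
    (h : ∀ i j, Tendsto (fun n => S n i j) atTop (𝓝 (M i j))) :
    Tendsto (fun n => entryDist (S n) M) atTop (𝓝 0) := by
  have h' : ∀ i j, Tendsto (fun n => |S n i j - M i j|) atTop (𝓝 0) := fun i j => by
    have := ((h i j).sub_const (M i j)).abs
    rwa [sub_self, abs_zero] at this
  simpa [entryDist] using (((h' 0 0).add (h' 0 1)).add (h' 1 0)).add (h' 1 1)

theorem tendsto_div_sub_div {a a' b b' : ℕ → ℝ} {κ K : ℝ} (hκ : 0 < κ) (hb : ∀ᶠ n in atTop, κ ≤ b n)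
    (hb' : ∀ n, κ ≤ b' n) (ha' : ∀ n, |a' n| ≤ K)
    (h1 : Tendsto (fun n => a n - a' n) atTop (𝓝 0))
    (h2 : Tendsto (fun n => b n - b' n) atTop (𝓝 0)) :
    Tendsto (fun n => a n / b n - a' n / b' n) atTop (𝓝 0) := by
  have h3 : Tendsto (fun n => κ⁻¹ * |a n - a' n| + K * (κ⁻¹ * κ⁻¹) * |b n - b' n|) atTop (𝓝 0) := by
    simpa using (h1.abs.const_mul κ⁻¹).add (h2.abs.const_mul (K * (κ⁻¹ * κ⁻¹)))
  refine squeeze_zero_norm' ?_ h3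
  filter_upwards [hb] with n hn
  have hbn : 0 < b n := hκ.trans_le hn
  have hbn' : 0 < b' n := hκ.trans_le (hb' n)
  have e : a n / b n - a' n / b' n =
      (b n)⁻¹ * (a n - a' n) - a' n * ((b n)⁻¹ * (b' n)⁻¹) * (b n - b' n) := by
    field_simp; ring
  rw [e, Real.norm_eq_abs]
  refine (abs_sub _ _).trans ?_
  rw [abs_mul, abs_mul, abs_mul, abs_of_pos (inv_pos.2 hbn),
    abs_of_pos (mul_pos (inv_pos.2 hbn) (inv_pos.2 hbn'))]
  have : 0 ≤ K := (abs_nonneg _).trans (ha' 0)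
  gcongr
  · exact ha' n
  · exact hb' n

/-! ### Averaging the quadratic coefficient. -/

section Average

variable {T : ℕ → Matrix (Fin 2) (Fin 2) ℝ} {h : ℕ → ℝ} {v : ℕ → Fin 2 → ℝ} {φ : ℝ}

theorem exists_form_lower_bound (hφ : φ ∈ Set.Ioo 0 Real.pi)
    (hT : ∀ i j, Tendsto (fun n => T n i j) atTop (𝓝 (limMat φ i j))) :
    ∃ N, ∀ n ≥ N, ∀ x, limBound φ / 2 * nsq x ≤ form (T n) x := by
  have hb := limBound_pos hφ
  have he := (tendsto_entryDist hT).eventually (gt_mem_nhds (half_pos hb))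
  obtain ⟨N, hN⟩ := he.exists_forall_of_atTop
  refine ⟨N, fun n hn x => ?_⟩
  have h1 := (abs_le.1 (abs_form_sub_le (T n) (limMat φ) x)).1
  have h2 := limBound_mul_nsq_le φ x
  have h3 := mul_le_mul_of_nonneg_right (hN n hn).le (nsq_nonneg x)
  linarith

/-- Homogeneity of degree zero reduces to unit vectors, where closeness of the matrices controls all
the forms uniformly whatever the sequence `w`. -/
theorem tendsto_quadCoef_sub (hφ : φ ∈ Set.Ioo 0 Real.pi)
    (hT : ∀ i j, Tendsto (fun n => T n i j) atTop (𝓝 (limMat φ i j)))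
    {w : ℕ → Fin 2 → ℝ} (hw : ∀ n, w n ≠ 0) :
    Tendsto (fun n => quadCoef (T n) (w n) - quadCoef (limMat φ) (w n)) atTop (𝓝 0) := by
  have hb := limBound_pos hφ
  have hn := fun n => nsq_dir (hw n)
  have hdist := tendsto_entryDist hT
  obtain ⟨N, hN⟩ := exists_form_lower_bound hφ hT
  have hl : ∀ᶠ n in atTop, limBound φ / 2 ≤ form (T n) (dir (w n)) := by
    filter_upwards [eventually_ge_atTop N] with n hNn
    simpa [hn n] using hN n hNn (dir (w n))
  have hl' : ∀ n, limBound φ * nsq (dir (w n)) ≤ form (limMat φ) (dir (w n)) :=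
    fun n => limBound_mul_nsq_le φ _
  have hl'' : ∀ n, limBound φ / 2 ≤ form (limMat φ) (dir (w n)) := fun n => by
    have := hl' n
    rw [hn n] at this
    linarith
  have hf : Tendsto (fun n => form (T n) (dir (w n)) - form (limMat φ) (dir (w n))) atTop (𝓝 0) :=
    squeeze_zero_norm (fun n => by
      simpa [hn n] using abs_form_sub_le (T n) (limMat φ) (dir (w n))) hdist
  have hk : Tendsto (fun n => kickForm (T n) (dir (w n)) - kickForm (limMat φ) (dir (w n))) atTop
      (𝓝 0) :=
    squeeze_zero_norm (fun n => by
      simpa [hn n] using abs_kickForm_sub_le (T n) (limMat φ) (dir (w n)))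
      (by simpa using hdist.const_mul 2)
  have ha : Tendsto (fun n => T n 0 1 * dir (w n) 0 ^ 2 - limMat φ 0 1 * dir (w n) 0 ^ 2) atTop
      (𝓝 0) := by
    refine squeeze_zero_norm (fun n => ?_) hdist
    have h1 : dir (w n) 0 ^ 2 ≤ 1 := (sq_le_one_iff_abs_le_one _).2 (abs_apply_le_one (hn n)).1
    rw [← sub_mul, norm_mul, Real.norm_eq_abs, Real.norm_of_nonneg (sq_nonneg _)]
    refine (mul_le_mul_of_nonneg_left h1 (abs_nonneg _)).trans ?_
    unfold entryDist
    linarith [abs_nonneg (T n 0 0 - limMat φ 0 0), abs_nonneg (T n 1 0 - limMat φ 1 0),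
      abs_nonneg (T n 1 1 - limMat φ 1 1)]
  have hkb : ∀ n, |kickForm (limMat φ) (dir (w n))| ≤ 2 * entryDist (limMat φ) 0 := fun n => by
    simpa [hn n, kickForm] using abs_kickForm_sub_le (limMat φ) 0 (dir (w n))
  have hab : ∀ n, |limMat φ 0 1 * dir (w n) 0 ^ 2| ≤ 1 := fun n => by
    have h1 : dir (w n) 0 ^ 2 ≤ 1 := (sq_le_one_iff_abs_le_one _).2 (abs_apply_le_one (hn n)).1
    rw [abs_of_nonneg (by simp [limMat]; positivity)]
    simpa [limMat] using h1
  have l1 := tendsto_div_sub_div (half_pos hb) hl hl'' hab ha hf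
  have l2 := tendsto_div_sub_div (half_pos hb) hl hl'' hkb hk hf
  have l3 : Tendsto (fun n => linCoef (limMat φ) (dir (w n)) *
      (linCoef (T n) (dir (w n)) - linCoef (limMat φ) (dir (w n)))) atTop (𝓝 0) := by
    refine bdd_le_mul_tendsto_zero' (2 * entryDist (limMat φ) 0 / limBound φ)
      (Eventually.of_forall fun n => ?_) l2
    exact abs_linCoef_le hb (dir_ne_zero (hw n)) (hl' n)
  have l4 := l1.sub (((l2.mul l2).add (l3.const_mul 2)).div_const 2)
  simp only [mul_zero, add_zero, zero_div, sub_zero] at l4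
  refine l4.congr fun n => ?_
  rw [← quadCoef_dir (T n) (hw n), ← quadCoef_dir (limMat φ) (hw n), quadCoef, quadCoef, linCoef,
    linCoef]
  ring

/-- If `e^{4iφ} = 1` then `2φ = mπ` with `0 < m < 2`, hence `φ = π/2`; the statement for `e^{2iφ}`
follows by squaring. -/
theorem exp_rotation_ne_one (hφ : φ ∈ Set.Ioo 0 Real.pi) (hφ₂ : φ ≠ Real.pi / 2) :
    Complex.exp (2 * (Complex.I * φ)) ≠ 1 ∧ Complex.exp (2 * (Complex.I * φ)) ^ 2 ≠ 1 := by
  have key : Complex.exp (2 * (Complex.I * φ)) ^ 2 ≠ 1 := by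
    rw [← Complex.exp_nat_mul]
    intro he
    obtain ⟨m, hm⟩ := Complex.exp_eq_one_iff.1 he
    have hm' := congrArg Complex.im hm
    simp at hm'
    have h1 : 2 * φ = m * Real.pi := by linarith
    have hpi := Real.pi_pos
    have h2 : (0 : ℝ) < m := by
      by_contra hc
      nlinarith [hφ.1]
    have h3 : (m : ℝ) < 2 := by nlinarith [hφ.2]
    have h4 : m = 1 := by
      have : (0 : ℤ) < m := by exact_mod_cast h2
      have : m < 2 := by exact_mod_cast h3
      omega
    rw [h4] at h1
    apply hφ₂
    push_cast at h1
    linarith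
  exact ⟨fun hc => key (by rw [hc, one_pow]), key⟩

/-- Logarithmic averages of the quadratic coefficient along an orbit. -/
theorem isLittleO_sum_quadCoef (hφ : φ ∈ Set.Ioo 0 Real.pi) (hφ₂ : φ ≠ Real.pi / 2)
    (hdet : ∀ n, (T n).det = 1)
    (hT : ∀ i j, Tendsto (fun n => T n i j) atTop (𝓝 (limMat φ i j)))
    (hv : ∀ n, v (n + 1) = (kickMat (h n) * T n).mulVec (v n)) (hv0 : v 0 ≠ 0)
    (hh : Tendsto h atTop (𝓝 0)) :
    (fun n => ∑ j ∈ Finset.range n, (quadCoef (T j) ((T j).mulVec (v j)) -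
      (4 * Real.sin φ ^ 2)⁻¹) * (1 / ((j : ℝ) + 1))) =o[atTop] harm := by
  have hne := orbit_ne_zero hdet hv hv0
  have hs := Real.sin_pos_of_mem_Ioo hφ
  set w : ℕ → Fin 2 → ℝ := fun n => (T n).mulVec (v n) with hwdef
  have hw : ∀ n, w n ≠ 0 := fun n => mulVec_ne_zero_of_det_eq_one (hdet n) (hne n)
  set q : ℕ → ℂ := fun n => pruferPhase φ (w n) with hq
  have hqn : ∀ n, ‖q n‖ = 1 := fun n => norm_pruferPhase hφ (hw n)
  -- The coefficients are evaluated just before the kick, so one step of `w` applies kick `n` first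
  -- and then cell `n + 1`.
  have hstep : ∀ n, w (n + 1) = (T (n + 1) * kickMat (h n)).mulVec (w n) := fun n => by
    simp only [hwdef]
    rw [hv, Matrix.mulVec_mulVec, Matrix.mulVec_mulVec, Matrix.mul_assoc]
  have hST : ∀ i j, Tendsto (fun n => (T (n + 1) * kickMat (h n)) i j) atTop
      (𝓝 (limMat φ i j)) := by
    have hT' : ∀ i j, Tendsto (fun n => T (n + 1) i j) atTop (𝓝 (limMat φ i j)) :=
      fun i j => (tendsto_add_atTop_iff_nat 1).2 (hT i j)
    intro i j
    fin_cases j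
    · have := (hT' i 0).add ((hT' i 1).mul hh)
      simpa [Matrix.mul_apply, Fin.sum_univ_two, kickMat] using this
    · simpa [Matrix.mul_apply, Fin.sum_univ_two, kickMat] using hT' i 1
  set ρ := Complex.exp (2 * (Complex.I * φ)) with hρ
  have hrot : Tendsto (fun n => q (n + 1) - ρ * q n) atTop (𝓝 0) := by
    refine squeeze_zero_norm (fun n => ?_) (a := fun n =>
      2 * ((1 / 2 + 3 / (2 * Real.sin φ)) * entryDist (T (n + 1) * kickMat (h n)) (limMat φ)) /
        √(limBound φ / (4 * Real.sin φ ^ 2))) ?_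
    · simp only [hq]
      rw [hstep]
      exact norm_pruferPhase_mulVec_sub_le hφ
        (by rw [Matrix.det_mul, det_kickMat, hdet, one_mul]) (hw n)
    · simpa using (((tendsto_entryDist hST).const_mul (1 / 2 + 3 / (2 * Real.sin φ))).const_mul
        2).div_const (√(limBound φ / (4 * Real.sin φ ^ 2)))
  have hrot2 : Tendsto (fun n => q (n + 1) ^ 2 - ρ ^ 2 * q n ^ 2) atTop (𝓝 0) := by
    refine squeeze_zero_norm (fun n => ?_) (by simpa using hrot.norm.mul_const 2)
    have e : q (n + 1) ^ 2 - ρ ^ 2 * q n ^ 2 =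
        (q (n + 1) - ρ * q n) * (q (n + 1) + ρ * q n) := by ring
    have hρ1 : ‖ρ‖ = 1 := by
      rw [hρ, Complex.norm_exp]; simp
    rw [e, norm_mul]
    gcongr
    refine (norm_add_le _ _).trans ?_
    rw [norm_mul, hρ1, hqn, hqn]
    norm_num
  obtain ⟨hρ1, hρ2⟩ := exp_rotation_ne_one hφ hφ₂
  have o1 := isLittleO_sum_rotating (fun n => (hqn n).le) hρ1 hrot
  have o2 := isLittleO_sum_rotating (z := fun n => q n ^ 2)
    (fun n => by rw [norm_pow, hqn, one_pow]) hρ2 hrot2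
  have o3 := isLittleO_sum_harm (f := fun n =>
    ((quadCoef (T n) (w n) - quadCoef (limMat φ) (w n) : ℝ) : ℂ)) (by
      have := (Complex.continuous_ofReal.tendsto 0).comp (tendsto_quadCoef_sub hφ hT hw)
      rwa [Complex.ofReal_zero] at this)
  have o4 := ((o1.const_mul_left (1 / 2)).add (o2.const_mul_left (1 / 4))).const_mul_left
    ((((Real.sin φ ^ 2)⁻¹ : ℝ)) : ℂ)
  refine ((Asymptotics.IsBigO.of_bound 1 (Eventually.of_forall fun n => ?_)).trans_isLittleO
    (o4.add o3))
  rw [one_mul, Real.norm_eq_abs]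
  refine le_trans (le_of_eq ?_) (Complex.abs_re_le_norm _)
  congr 1
  rw [Finset.mul_sum, Finset.mul_sum, ← Finset.sum_add_distrib, Finset.mul_sum,
    ← Finset.sum_add_distrib, Complex.re_sum]
  refine Finset.sum_congr rfl fun j _ => ?_
  have e : (((Real.sin φ ^ 2)⁻¹ : ℝ) : ℂ) * (1 / 2 * (q j * ((1 / ((j : ℝ) + 1) : ℝ) : ℂ)) +
      1 / 4 * (q j ^ 2 * ((1 / ((j : ℝ) + 1) : ℝ) : ℂ))) +
      ((quadCoef (T j) (w j) - quadCoef (limMat φ) (w j) : ℝ) : ℂ) * ((1 / ((j : ℝ) + 1) : ℝ) : ℂ) =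
      ((1 / ((j : ℝ) + 1) : ℝ) : ℂ) * ((((Real.sin φ ^ 2)⁻¹ : ℝ) : ℂ) *
        (((1 / 2 : ℝ) : ℂ) * q j + ((1 / 4 : ℝ) : ℂ) * q j ^ 2) +
        ((quadCoef (T j) (w j) - quadCoef (limMat φ) (w j) : ℝ) : ℂ)) := by
    push_cast; ring
  rw [e, Complex.re_ofReal_mul, Complex.add_re, Complex.re_ofReal_mul, Complex.add_re,
    Complex.re_ofReal_mul, Complex.re_ofReal_mul, Complex.ofReal_re, quadCoef_limMat hφ (hw j)]
  field_simp
  ring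

end Average

/-! ### Convergence of random series with predictable coefficients. -/

section Martingale

variable {Ω : Type*} [mΩ : MeasurableSpace Ω] {ν : Measure Ω} {h : ℕ → Ω → ℝ}

/-- The filtration whose `n`-th σ-algebra is generated by `h_0, …, h_{n-1}`. -/
def pastFiltration (h : ℕ → Ω → ℝ) (hm : ∀ n, Measurable (h n)) : Filtration ℕ mΩ where
  seq n := ⨆ j ∈ Set.Iio n, MeasurableSpace.comap (h j) inferInstance
  mono' _ _ hij := biSup_mono fun _ hk => lt_of_lt_of_le hk hij
  le' _ := iSup₂_le fun j _ => (hm j).comap_le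

theorem measurable_past (hm : ∀ n, Measurable (h n)) (n : ℕ) :
    Measurable[pastFiltration h hm (n + 1)] (h n) := by
  refine Measurable.of_comap_le ?_
  exact le_biSup (fun j => MeasurableSpace.comap (h j) inferInstance) (Set.mem_Iio.2 n.lt_succ_self)

theorem indep_past (hm : ∀ n, Measurable (h n)) (hi : iIndepFun h ν) (n : ℕ) :
    Indep (MeasurableSpace.comap (h n) inferInstance) (pastFiltration h hm n) ν := by
  have := indep_iSup_of_disjoint (m := fun j => MeasurableSpace.comap (h j) inferInstance)
    (fun j => (hm j).comap_le) hi (S := {n}) (T := Set.Iio n) (by simp)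
  rw [iSup_singleton] at this
  exact this

/-- Almost sure convergence of a series of independent centred terms with bounded predictable
coefficients and summable variances. -/
theorem ae_tendsto_sum_mul_predictable [IsProbabilityMeasure ν]
    (hm : ∀ n, Measurable (h n)) (hi : iIndepFun h ν)
    {F : ℕ → ℝ → ℝ} (hF : ∀ n, Measurable (F n)) {B : ℕ → ℝ} (hB : ∀ n ω, |F n (h n ω)| ≤ B n)
    (hmean : ∀ n, ∫ ω, F n (h n ω) ∂ν = 0) {σ : ℕ → ℝ} (hvar : ∀ n, ∫ ω, F n (h n ω) ^ 2 ∂ν ≤ σ n)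
    {ξ : ℕ → Ω → ℝ} (hξ : ∀ n, Measurable[pastFiltration h hm n] (ξ n)) {K : ℝ}
    (hK : ∀ n ω, |ξ n ω| ≤ K) {c : ℕ → ℝ} (hsum : Summable fun n => c n ^ 2 * σ n) :
    ∀ᵐ ω ∂ν, ∃ l, Tendsto (fun n => ∑ j ∈ Finset.range n, c j * (F j (h j ω) * ξ j ω)) atTop
      (𝓝 l) := by
  set ℱ := pastFiltration h hm with hℱ
  set Y : ℕ → Ω → ℝ := fun n ω => F n (h n ω) with hY
  set S : ℕ → Ω → ℝ := fun n ω => ∑ j ∈ Finset.range n, c j * (Y j ω * ξ j ω) with hS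
  have hSs : ∀ n ω, S (n + 1) ω = S n ω + c n * (Y n ω * ξ n ω) := fun n ω => by
    simp only [hS, Finset.sum_range_succ]
  have hYm : ∀ n, Measurable (Y n) := fun n => (hF n).comp (hm n)
  have hYpast : ∀ n, Measurable[ℱ (n + 1)] (Y n) := fun n => (hF n).comp (measurable_past hm n)
  have hξm : ∀ n, Measurable (ξ n) := fun n => (hξ n).mono (ℱ.le n) le_rfl
  have hSpast : ∀ n, Measurable[ℱ n] (S n) := by
    intro n
    refine Finset.measurable_fun_sum _ fun j hj => ?_
    have hj' : j + 1 ≤ n := Finset.mem_range.1 hj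
    have h1 := (hYpast j).mono (ℱ.mono hj') le_rfl
    have h2 := (hξ j).mono (ℱ.mono (Nat.le_of_succ_le hj')) le_rfl
    exact (h1.mul h2).const_mul _
  have hSm : ∀ n, Measurable (S n) := fun n => (hSpast n).mono (ℱ.le n) le_rfl
  have hSb : ∀ n, ∃ C, ∀ ω, |S n ω| ≤ C := by
    intro n
    refine ⟨∑ j ∈ Finset.range n, |c j| * (B j * K), fun ω => ?_⟩
    refine (Finset.abs_sum_le_sum_abs _ _).trans (Finset.sum_le_sum fun j _ => ?_)
    rw [abs_mul, abs_mul]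
    have := (abs_nonneg _).trans (hB j ω)
    gcongr
    · exact hB j ω
    · exact hK j ω
  have bint : ∀ {f : Ω → ℝ}, Measurable f → (∃ C, ∀ ω, |f ω| ≤ C) → Integrable f ν :=
    fun hf ⟨C, hC⟩ => Integrable.of_bound hf.aestronglyMeasurable C (ae_of_all _ hC)
  have bmul : ∀ {f g : Ω → ℝ}, (∃ C, ∀ ω, |f ω| ≤ C) → (∃ C, ∀ ω, |g ω| ≤ C) →
      ∃ C, ∀ ω, |f ω * g ω| ≤ C := by
    rintro f g ⟨C, hC⟩ ⟨D, hD⟩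
    refine ⟨C * D, fun ω => ?_⟩
    rw [abs_mul]
    have := (abs_nonneg _).trans (hC ω)
    gcongr
    · exact hC ω
    · exact hD ω
  have hYb : ∀ n, ∃ C, ∀ ω, |Y n ω| ≤ C := fun n => ⟨B n, hB n⟩
  have hξb : ∀ n, ∃ C, ∀ ω, |ξ n ω| ≤ C := fun n => ⟨K, hK n⟩
  have hindep : ∀ n, Indep (MeasurableSpace.comap (Y n) inferInstance) (ℱ n) ν := fun n =>
    indep_of_indep_of_le_left (indep_past hm hi n)
      ((hF n).comp (comap_measurable (h n))).comap_le
  have hmart : Martingale S ℱ ν := by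
    refine martingale_of_condExp_sub_eq_zero_nat (fun n => (hSpast n).stronglyMeasurable)
      (fun n => bint (hSm n) (hSb n)) fun n => ?_
    have e : S (n + 1) - S n = (fun ω => c n * ξ n ω) * Y n := by
      funext ω
      simp only [Pi.sub_apply, Pi.mul_apply, hSs]
      ring
    rw [e]
    have hcξ : Measurable[ℱ n] fun ω => c n * ξ n ω := (hξ n).const_mul _
    have hpull := condExp_mul_of_stronglyMeasurable_left (μ := ν) (m := ℱ n)
      hcξ.stronglyMeasurable (g := Y n)
      (bint ((hcξ.mono (ℱ.le n) le_rfl).mul (hYm n)) (bmul (bmul ⟨|c n|, fun _ => le_rfl⟩ (hξb n))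
        (hYb n))) (bint (hYm n) (hYb n))
    have hce := condExp_indep_eq (hYm n).comap_le (ℱ.le n)
      (comap_measurable (Y n)).stronglyMeasurable (hindep n)
    filter_upwards [hpull, hce] with ω h1 h2
    rw [h1, Pi.mul_apply, h2]
    simp [hY, hmean n]
  -- Orthogonality of the increments: `Y n` is centred and independent of the past, which contains
  -- `S n * ξ n`, so the cross term vanishes.
  have hL2 : ∀ n, ∫ ω, S n ω ^ 2 ∂ν ≤ ∑ j ∈ Finset.range n, K ^ 2 * (c j ^ 2 * σ j) := by
    intro n
    induction n with
    | zero => simp [hS]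
    | succ n ih =>
      have hSξ : Measurable[ℱ n] fun ω => S n ω * ξ n ω := (hSpast n).mul (hξ n)
      have hI : IndepFun (Y n) (fun ω => S n ω * ξ n ω) ν := by
        rw [IndepFun_iff_Indep]
        exact indep_of_indep_of_le_right (hindep n) hSξ.comap_le
      have hcross : ∫ ω, Y n ω * (S n ω * ξ n ω) ∂ν = 0 := by
        rw [hI.integral_fun_mul_eq_mul_integral (hYm n).aestronglyMeasurable
          (hSξ.mono (ℱ.le n) le_rfl).aestronglyMeasurable]
        simp [hY, hmean n]
      have hi1 : Integrable (fun ω => S n ω ^ 2) ν := by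
        simp only [sq]; exact bint ((hSm n).mul (hSm n)) (bmul (hSb n) (hSb n))
      have hi2 : Integrable (fun ω => 2 * c n * (Y n ω * (S n ω * ξ n ω))) ν :=
        (bint ((hYm n).mul ((hSm n).mul (hξm n)))
          (bmul (hYb n) (bmul (hSb n) (hξb n)))).const_mul _
      have hYξ := bmul (hYb n) (hξb n)
      have hi3 : Integrable (fun ω => c n ^ 2 * (Y n ω * ξ n ω) ^ 2) ν := by
        simp only [sq (_ * _)]
        exact (bint (((hYm n).mul (hξm n)).mul ((hYm n).mul (hξm n)))
          (bmul hYξ hYξ)).const_mul _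
      have e : ∀ ω, S (n + 1) ω ^ 2 = S n ω ^ 2 + 2 * c n * (Y n ω * (S n ω * ξ n ω)) +
          c n ^ 2 * (Y n ω * ξ n ω) ^ 2 := fun ω => by rw [hSs]; ring
      have hi4 : Integrable (fun ω => Y n ω ^ 2) ν := by
        simp only [sq]; exact bint ((hYm n).mul (hYm n)) (bmul (hYb n) (hYb n))
      have hlast : ∫ ω, c n ^ 2 * (Y n ω * ξ n ω) ^ 2 ∂ν ≤ K ^ 2 * (c n ^ 2 * σ n) := by
        calc ∫ ω, c n ^ 2 * (Y n ω * ξ n ω) ^ 2 ∂ν ≤ ∫ ω, c n ^ 2 * K ^ 2 * Y n ω ^ 2 ∂ν := by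
              refine integral_mono hi3 (hi4.const_mul _) fun ω => ?_
              have : ξ n ω ^ 2 ≤ K ^ 2 := sq_le_sq' (abs_le.1 (hK n ω)).1 (abs_le.1 (hK n ω)).2
              simp only [mul_pow]
              calc c n ^ 2 * (Y n ω ^ 2 * ξ n ω ^ 2) ≤ c n ^ 2 * (Y n ω ^ 2 * K ^ 2) := by gcongr
                _ = _ := by ring
          _ = c n ^ 2 * K ^ 2 * ∫ ω, Y n ω ^ 2 ∂ν := integral_const_mul _ _
          _ ≤ c n ^ 2 * K ^ 2 * σ n := by gcongr; exact hvar n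
          _ = _ := by ring
      rw [integral_congr_ae (ae_of_all _ e), integral_add
        (f := fun ω => S n ω ^ 2 + 2 * c n * (Y n ω * (S n ω * ξ n ω))) (hi1.add hi2) hi3,
        integral_add hi1 hi2, integral_const_mul, hcross, mul_zero, add_zero,
        Finset.sum_range_succ]
      exact add_le_add ih hlast
  have hσ : ∀ n, 0 ≤ c n ^ 2 * σ n := fun n =>
    mul_nonneg (sq_nonneg _) ((integral_nonneg fun ω => sq_nonneg _).trans (hvar n))
  -- The bound `|S| ≤ 1 + S²` turns the second moment estimate into the `L¹` bound required by the
  -- martingale convergence theorem.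
  have hL1 : ∀ n, eLpNorm (S n) 1 ν ≤
      ((1 + ∑' j, K ^ 2 * (c j ^ 2 * σ j)).toNNReal : ENNReal) := by
    intro n
    have hint := bint (hSm n) (hSb n)
    have hi1 : Integrable (fun ω => S n ω ^ 2) ν := by
      simp only [sq]; exact bint ((hSm n).mul (hSm n)) (bmul (hSb n) (hSb n))
    rw [eLpNorm_one_eq_lintegral_enorm, ← ofReal_integral_norm_eq_lintegral_enorm hint]
    refine ENNReal.ofReal_le_ofReal ?_
    calc ∫ ω, ‖S n ω‖ ∂ν ≤ ∫ ω, (1 + S n ω ^ 2) ∂ν := by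
          refine integral_mono hint.norm ((integrable_const 1).add hi1) fun ω => ?_
          rw [Real.norm_eq_abs, ← sq_abs]
          nlinarith [sq_nonneg (|S n ω| - 1), sq_nonneg (|S n ω|)]
      _ = 1 + ∫ ω, S n ω ^ 2 ∂ν := by
          rw [integral_add (integrable_const 1) hi1]; simp
      _ ≤ 1 + ∑' j, K ^ 2 * (c j ^ 2 * σ j) := by
          gcongr
          exact (hL2 n).trans ((hsum.mul_left _).sum_le_tsum _ fun j _ =>
            mul_nonneg (sq_nonneg _) (hσ j))
  filter_upwards [hmart.submartingale.ae_tendsto_limitProcess hL1] with ω hω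
  exact ⟨_, hω⟩

end Martingale

/-! ### Kronecker's lemma and assembly along one orbit. -/

theorem harm_succ (n : ℕ) : harm (n + 1) = harm n + 1 / ((n : ℝ) + 1) := by
  simp [harm, Finset.sum_range_succ]

theorem harm_succ_pos (n : ℕ) : 0 < harm (n + 1) :=
  Finset.sum_pos (fun j _ => by positivity) (by simp)

theorem harm_eq_sum_Icc (n : ℕ) : harm n = ∑ j ∈ Finset.Icc 1 n, 1 / (j : ℝ) := by
  induction n with
  | zero => simp [harm]
  | succ n ih => rw [harm_succ, Finset.sum_Icc_succ_top (by omega), ih]; push_cast; rfl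

theorem isLittleO_sum_harm_real {f : ℕ → ℝ} (hf : Tendsto f atTop (𝓝 0)) :
    (fun n => ∑ j ∈ Finset.range n, f j * (1 / ((j : ℝ) + 1))) =o[atTop] harm := by
  refine Asymptotics.IsLittleO.sum_range (g := fun j : ℕ => 1 / ((j : ℝ) + 1)) ?_
    (fun j => by positivity) harm_tendsto
  simpa using ((Asymptotics.isLittleO_one_iff ℝ).2 hf).mul_isBigO
    (Asymptotics.isBigO_refl (fun j : ℕ => 1 / ((j : ℝ) + 1)) atTop)

theorem isLittleO_harm_of_tendsto {f : ℕ → ℝ} {l : ℝ} (hf : Tendsto f atTop (𝓝 l)) :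
    f =o[atTop] harm := by
  refine (hf.isBigO_one ℝ).trans_isLittleO ?_
  rw [Asymptotics.isLittleO_const_left]
  right
  exact tendsto_norm_atTop_atTop.comp harm_tendsto

/-- Kronecker's lemma for the harmonic weights. -/
theorem isLittleO_sum_of_tendsto_sum_div {x : ℕ → ℝ} {l : ℝ}
    (hx : Tendsto (fun n => ∑ j ∈ Finset.range n, (harm (j + 1))⁻¹ * x j) atTop (𝓝 l)) :
    (fun n => ∑ j ∈ Finset.range n, x j) =o[atTop] harm := by
  set S : ℕ → ℝ := fun n => ∑ j ∈ Finset.range n, (harm (j + 1))⁻¹ * x j with hS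
  have hSl : Tendsto (fun n => S n - l) atTop (𝓝 0) := by
    simpa using hx.sub_const l
  have h1 : (fun n => (S n - l) * harm n) =o[atTop] harm := by
    simpa using ((Asymptotics.isLittleO_one_iff ℝ).2 hSl).mul_isBigO
      (Asymptotics.isBigO_refl harm atTop)
  -- Abel summation gives `∑ x_j = (S n - l) harm n - ∑ (S j - l)/(j + 1)`, and both terms are
  -- `o(harm)`.
  refine (h1.sub (isLittleO_sum_harm_real hSl)).congr_left fun n => ?_
  induction n with
  | zero => simp [harm]
  | succ n ih =>
    have h0 := (harm_succ_pos n).ne'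
    have hSn : S (n + 1) = S n + (harm (n + 1))⁻¹ * x n := by
      simp only [hS, Finset.sum_range_succ]
    rw [Finset.sum_range_succ, Finset.sum_range_succ, ← ih, hSn]
    have e : (S n + (harm (n + 1))⁻¹ * x n - l) * harm (n + 1) =
        (S n - l) * harm (n + 1) + x n := by field_simp; ring
    rw [e, harm_succ]
    ring

/-- After dropping the first term, the summand is dominated by the difference of consecutive values
of `1/harm`, which telescopes. This makes `1/harm` an admissible weight for variances of order
`1/n`. -/
theorem summable_inv_harm_sq (m : ℝ) :
    Summable fun n : ℕ => (harm (n + 1))⁻¹ ^ 2 * (m * ((n : ℝ) + 1)⁻¹) := by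
  have key : Summable fun n : ℕ => (harm (n + 1))⁻¹ ^ 2 * ((n : ℝ) + 1)⁻¹ := by
    rw [← summable_nat_add_iff 1]
    refine summable_of_sum_range_le (c := (harm 1)⁻¹) (fun n => by positivity) fun n => ?_
    calc ∑ j ∈ Finset.range n, (harm (j + 1 + 1))⁻¹ ^ 2 * (((j + 1 : ℕ) : ℝ) + 1)⁻¹
        ≤ ∑ j ∈ Finset.range n, ((harm (j + 1))⁻¹ - (harm (j + 1 + 1))⁻¹) := by
          refine Finset.sum_le_sum fun j _ => ?_
          have h1 := harm_succ_pos j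
          have h2 := harm_succ (j + 1)
          have h3 := harm_succ_pos (j + 1)
          have h4 : harm (j + 1) ≤ harm (j + 1 + 1) := by
            rw [h2]; linarith [show 0 ≤ 1 / (((j + 1 : ℕ) : ℝ) + 1) by positivity]
          have e : (harm (j + 1))⁻¹ - (harm (j + 1 + 1))⁻¹ =
              (harm (j + 1 + 1))⁻¹ * (harm (j + 1))⁻¹ * (((j + 1 : ℕ) : ℝ) + 1)⁻¹ := by
            have : harm (j + 1 + 1) - harm (j + 1) = (((j + 1 : ℕ) : ℝ) + 1)⁻¹ := by
              rw [h2]; ring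
            rw [← this]; field_simp
          rw [e, sq]
          gcongr
      _ = (harm 1)⁻¹ - (harm (n + 1))⁻¹ := by
          rw [Finset.sum_range_sub' fun j => (harm (j + 1))⁻¹]
      _ ≤ _ := by linarith [inv_pos.2 (harm_succ_pos n)]
  exact (key.mul_left m).congr fun n => by ring

theorem bounded_entryDist {T : ℕ → Matrix (Fin 2) (Fin 2) ℝ} {M : Matrix (Fin 2) (Fin 2) ℝ}
    (hT : ∀ i j, Tendsto (fun n => T n i j) atTop (𝓝 (M i j))) :
    ∃ B, ∀ n, entryDist (T n) 0 ≤ B := by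
  have h' : ∀ i j, Tendsto (fun n => |T n i j - (0 : Matrix (Fin 2) (Fin 2) ℝ) i j|) atTop
      (𝓝 (|M i j|)) := fun i j => by
    simpa using (hT i j).abs
  obtain ⟨B, hB⟩ :=
    ((((h' 0 0).add (h' 0 1)).add (h' 1 0)).add (h' 1 1)).bddAbove_range
  exact ⟨B, fun n => hB ⟨n, rfl⟩⟩

/-- Growth of the limiting form along one orbit, given the two fluctuation estimates. -/
theorem isLittleO_log_form_sub {T : ℕ → Matrix (Fin 2) (Fin 2) ℝ} {h : ℕ → ℝ}
    {v : ℕ → Fin 2 → ℝ} {φ : ℝ} (hφ : φ ∈ Set.Ioo 0 Real.pi) (hφ₂ : φ ≠ Real.pi / 2)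
    (hdet : ∀ n, (T n).det = 1)
    (hT : ∀ i j, Tendsto (fun n => T n i j) atTop (𝓝 (limMat φ i j)))
    (hsum : Summable fun n => entryDist (T (n + 1)) (T n))
    (hv : ∀ n, v (n + 1) = (kickMat (h n) * T n).mulVec (v n)) (hv0 : v 0 ≠ 0)
    (hh : Summable fun n => |h n| ^ 3)
    {N : ℕ} (hlow : ∀ n ≥ N, ∀ x, limBound φ / 2 * nsq x ≤ form (T n) x) {m : ℝ}
    (h₁ : (fun n => ∑ j ∈ Finset.range n,
      h j * (if N ≤ j then linCoef (T j) ((T j).mulVec (v j)) else 0)) =o[atTop] harm)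
    (h₂ : (fun n => ∑ j ∈ Finset.range n, (h j ^ 2 - m * ((j : ℝ) + 1)⁻¹) *
      (if N ≤ j then quadCoef (T j) ((T j).mulVec (v j)) else 0)) =o[atTop] harm) :
    (fun n => Real.log (form (limMat φ) (v n)) - m * (4 * Real.sin φ ^ 2)⁻¹ * harm n)
      =o[atTop] harm := by
  have hb := half_pos (limBound_pos hφ)
  have hne := orbit_ne_zero hdet hv hv0
  obtain ⟨B, hB⟩ := bounded_entryDist hT
  obtain ⟨e, hes, he⟩ := exists_summable_log_form hdet hv hv0 hb hlow hB hsum hh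
  have o1 := isLittleO_harm_of_tendsto hes.hasSum.tendsto_sum_nat
  have o2 : (fun n => Real.log (form (limMat φ) (v n)) - Real.log (form (T n) (v n)))
      =o[atTop] harm := by
    refine isLittleO_harm_of_tendsto (l := 0) ?_
    refine squeeze_zero_norm' ?_ (by simpa using (tendsto_entryDist hT).div_const (limBound φ / 2))
    filter_upwards [eventually_ge_atTop N] with n hn
    rw [norm_sub_rev]
    refine abs_log_form_sub_le hb (hne n) (hlow n hn _) ((limBound_mul_nsq_le φ _).trans' ?_)
    have := mul_nonneg (limBound_pos hφ).le (nsq_nonneg (v n))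
    linarith
  have o3 := isLittleO_harm_of_tendsto
    (tendsto_const_nhds (x := Real.log (form (T 0) (v 0))) (f := (atTop : Filter ℕ)))
  have o4 := (isLittleO_sum_quadCoef hφ hφ₂ hdet hT hv hv0
    (tendsto_zero_of_summable_cube hh)).const_mul_left m
  -- The cutoff at `N` discards the indices where positivity of `form (T j)` is not known; it
  -- changes finitely many terms.
  have o5 := (isLittleO_sum_harm_real (f := fun j =>
    (if N ≤ j then quadCoef (T j) ((T j).mulVec (v j)) else 0) -
      quadCoef (T j) ((T j).mulVec (v j))) (by
    refine tendsto_const_nhds.congr' ?_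
    filter_upwards [eventually_ge_atTop N] with n hn
    simp [hn])).const_mul_left m
  refine (((((o1.add o2).add o3).add o4).add o5).add (h₁.add h₂)).congr_left fun n => ?_
  have hn := he n
  have hr : ∀ j, (if N ≤ j then h j * linCoef (T j) ((T j).mulVec (v j)) +
        h j ^ 2 * quadCoef (T j) ((T j).mulVec (v j)) else 0) =
      h j * (if N ≤ j then linCoef (T j) ((T j).mulVec (v j)) else 0) +
        h j ^ 2 * (if N ≤ j then quadCoef (T j) ((T j).mulVec (v j)) else 0) := fun j => by
    split_ifs <;> ring
  have hsplit : ∑ j ∈ Finset.range n, ((if N ≤ j then h j * linCoef (T j) ((T j).mulVec (v j)) +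
        h j ^ 2 * quadCoef (T j) ((T j).mulVec (v j)) else 0) + e j) =
      ∑ j ∈ Finset.range n, e j + m * ∑ j ∈ Finset.range n,
        (quadCoef (T j) ((T j).mulVec (v j)) - (4 * Real.sin φ ^ 2)⁻¹) * (1 / ((j : ℝ) + 1)) +
      m * ∑ j ∈ Finset.range n, ((if N ≤ j then quadCoef (T j) ((T j).mulVec (v j)) else 0) -
        quadCoef (T j) ((T j).mulVec (v j))) * (1 / ((j : ℝ) + 1)) +
      (∑ j ∈ Finset.range n, h j * (if N ≤ j then linCoef (T j) ((T j).mulVec (v j)) else 0) +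
        ∑ j ∈ Finset.range n, (h j ^ 2 - m * ((j : ℝ) + 1)⁻¹) *
          (if N ≤ j then quadCoef (T j) ((T j).mulVec (v j)) else 0)) +
      m * (4 * Real.sin φ ^ 2)⁻¹ * harm n := by
    rw [harm, Finset.mul_sum, Finset.mul_sum, Finset.mul_sum, ← Finset.sum_add_distrib,
      ← Finset.sum_add_distrib, ← Finset.sum_add_distrib, ← Finset.sum_add_distrib,
      ← Finset.sum_add_distrib]
    refine Finset.sum_congr rfl fun j _ => ?_
    rw [hr, one_div]
    ring
  rw [hsplit] at hn
  linarith

/-! ### The random orbit. -/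

/-- The orbit of an initial vector under the random transfer matrices. -/
def orbit (T : ℕ → Matrix (Fin 2) (Fin 2) ℝ) (h : ℕ → ℝ) (v₀ : Fin 2 → ℝ) : ℕ → Fin 2 → ℝ
  | 0 => v₀
  | n + 1 => (kickMat (h n) * T n).mulVec (orbit T h v₀ n)

section Random

variable {Ω : Type*} [mΩ : MeasurableSpace Ω] {ν : Measure Ω} [IsProbabilityMeasure ν]
  {h : ℕ → Ω → ℝ}

theorem measurable_orbit (T : ℕ → Matrix (Fin 2) (Fin 2) ℝ) (hm : ∀ n, Measurable (h n))
    (v₀ : Fin 2 → ℝ) (n : ℕ) (i : Fin 2) :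
    Measurable[pastFiltration h hm n] fun ω => orbit T (fun j => h j ω) v₀ n i := by
  induction n generalizing i with
  | zero => exact measurable_const
  | succ n ih =>
    have hle := (pastFiltration h hm).mono n.le_succ
    have h0 := (ih 0).mono hle le_rfl
    have h1 := (ih 1).mono hle le_rfl
    have hn := measurable_past hm n
    simp only [orbit, ← Matrix.mulVec_mulVec]
    fin_cases i
    · simp only [Fin.zero_eta, mulVec_zero', mulVec_one', kickMat]
      simp only [Matrix.of_apply, Matrix.cons_val', Matrix.cons_val_zero, Matrix.cons_val_one,
        Matrix.cons_val_fin_one]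
      fun_prop
    · simp only [Fin.mk_one, mulVec_zero', mulVec_one', kickMat]
      simp only [Matrix.of_apply, Matrix.cons_val', Matrix.cons_val_zero, Matrix.cons_val_one,
        Matrix.cons_val_fin_one]
      fun_prop

/-- The vector before kick `n` involves only the couplings of index below `n`, so the coefficients
are predictable. -/
theorem measurable_coef (T : ℕ → Matrix (Fin 2) (Fin 2) ℝ) (hm : ∀ n, Measurable (h n))
    (v₀ : Fin 2 → ℝ) (n : ℕ) :
    (Measurable[pastFiltration h hm n] fun ω =>
        linCoef (T n) ((T n).mulVec (orbit T (fun j => h j ω) v₀ n))) ∧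
      Measurable[pastFiltration h hm n] fun ω =>
        quadCoef (T n) ((T n).mulVec (orbit T (fun j => h j ω) v₀ n)) := by
  have h0 := measurable_orbit T hm v₀ n 0
  have h1 := measurable_orbit T hm v₀ n 1
  constructor
  · simp only [linCoef, kickForm, form, mulVec_zero', mulVec_one']
    fun_prop
  · simp only [quadCoef, linCoef, kickForm, form, mulVec_zero', mulVec_one']
    fun_prop

/-- Almost sure growth of the limiting form along the random orbit. -/
theorem ae_isLittleO_log_form_sub {T : ℕ → Matrix (Fin 2) (Fin 2) ℝ} {φ : ℝ}
    (hφ : φ ∈ Set.Ioo 0 Real.pi) (hφ₂ : φ ≠ Real.pi / 2) (hdet : ∀ n, (T n).det = 1)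
    (hT : ∀ i j, Tendsto (fun n => T n i j) atTop (𝓝 (limMat φ i j)))
    (hsum : Summable fun n => entryDist (T (n + 1)) (T n))
    (hm : ∀ n, Measurable (h n)) (hi : iIndepFun h ν) {m C D : ℝ}
    (hvar : ∀ n, ∫ ω, h n ω ^ 2 ∂ν = m * ((n : ℝ) + 1)⁻¹)
    (hfour : ∀ n, ∫ ω, h n ω ^ 4 ∂ν ≤ C * (((n : ℝ) + 1) ^ 2)⁻¹)
    (hmean : ∀ n, ∫ ω, h n ω ∂ν = 0) (hbdd : ∀ n ω, |h n ω| ≤ D)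
    (hcube : ∀ ω, Summable fun n => |h n ω| ^ 3) {v₀ : Fin 2 → ℝ} (hv₀ : v₀ ≠ 0) :
    ∀ᵐ ω ∂ν, (fun n => Real.log (form (limMat φ) (orbit T (fun j => h j ω) v₀ n)) -
      m * (4 * Real.sin φ ^ 2)⁻¹ * harm n) =o[atTop] harm := by
  have hb := half_pos (limBound_pos hφ)
  obtain ⟨N, hN⟩ := exists_form_lower_bound hφ hT
  obtain ⟨B, hB⟩ := bounded_entryDist hT
  have hB0 : 0 ≤ B := le_trans (by unfold entryDist; positivity) (hB 0)
  have hw : ∀ ω n, (T n).mulVec (orbit T (fun j => h j ω) v₀ n) ≠ 0 := fun ω n =>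
    mulVec_ne_zero_of_det_eq_one (hdet n)
      (orbit_ne_zero (v := orbit T (fun j => h j ω) v₀) hdet (fun _ => rfl) hv₀ n)
  have hlin : ∀ n, N ≤ n → ∀ ω,
      |linCoef (T n) ((T n).mulVec (orbit T (fun j => h j ω) v₀ n))| ≤
        2 * B / (limBound φ / 2) := fun n hn ω => by
    refine (abs_linCoef_le hb (hw ω n) (hN n hn _)).trans ?_
    gcongr
    exact hB n
  have hquad : ∀ n, N ≤ n → ∀ ω,
      |quadCoef (T n) ((T n).mulVec (orbit T (fun j => h j ω) v₀ n))| ≤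
        B / (limBound φ / 2) + (2 * B / (limBound φ / 2)) ^ 2 / 2 := fun n hn ω => by
    rw [quadCoef]
    refine (abs_sub _ _).trans (add_le_add ?_ ?_)
    · refine (abs_sq_coef_le hb (hw ω n) (hN n hn _)).trans ?_
      gcongr
      exact hB n
    · rw [abs_div, abs_two, abs_pow]
      gcongr
      exact hlin n hn ω
  have bint : ∀ {f : Ω → ℝ} {c : ℝ}, Measurable f → (∀ ω, |f ω| ≤ c) → Integrable f ν :=
    fun hf hC => Integrable.of_bound hf.aestronglyMeasurable _ (ae_of_all _ hC)
  have hi2 : ∀ n, Integrable (fun ω => h n ω ^ 2) ν := fun n =>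
    bint (c := D ^ 2) ((hm n).pow_const 2) fun ω => by
      rw [abs_pow]; gcongr; exact hbdd n ω
  have hi4 : ∀ n, Integrable (fun ω => h n ω ^ 4) ν := fun n =>
    bint (c := D ^ 4) ((hm n).pow_const 4) fun ω => by
      rw [abs_pow]; gcongr; exact hbdd n ω
  -- The weights `c n` are fixed by unification with `summable_inv_harm_sq`: they are `(harm (n +
  -- 1))⁻¹`, as Kronecker's lemma requires.
  have r1 := ae_tendsto_sum_mul_predictable hm hi (F := fun _ x => x) (fun _ => measurable_id)
    (B := fun _ => D) hbdd hmean (σ := fun n => m * ((n : ℝ) + 1)⁻¹) (fun n => (hvar n).le)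
    (ξ := fun n ω =>
      if N ≤ n then linCoef (T n) ((T n).mulVec (orbit T (fun j => h j ω) v₀ n)) else 0)
    (fun n => by
      by_cases hn : N ≤ n
      · simpa [hn] using (measurable_coef T hm v₀ n).1
      · simp [hn])
    (K := 2 * B / (limBound φ / 2)) (fun n ω => by
      split_ifs with hn
      · exact hlin n hn ω
      · rw [abs_zero]; positivity)
    (summable_inv_harm_sq m)
  -- The variance of the centred square is at most the fourth moment, of order `n⁻²`, so this series
  -- converges without weights.
  have r2 := ae_tendsto_sum_mul_predictable hm hi (F := fun n x => x ^ 2 - m * ((n : ℝ) + 1)⁻¹)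
    (fun n => by fun_prop) (B := fun n => D ^ 2 + |m * ((n : ℝ) + 1)⁻¹|)
    (fun n ω => by
      refine (abs_sub _ _).trans ?_
      rw [abs_pow]
      gcongr
      exact hbdd n ω)
    (fun n => by
      rw [integral_sub (hi2 n) (integrable_const _), hvar]
      simp)
    (σ := fun n => C * (((n : ℝ) + 1) ^ 2)⁻¹)
    (fun n => by
      have e : ∀ ω, (h n ω ^ 2 - m * ((n : ℝ) + 1)⁻¹) ^ 2 = h n ω ^ 4 -
          2 * (m * ((n : ℝ) + 1)⁻¹) * h n ω ^ 2 + (m * ((n : ℝ) + 1)⁻¹) ^ 2 := fun ω => by ring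
      rw [integral_congr_ae (ae_of_all _ e),
        integral_add (f := fun ω => h n ω ^ 4 - 2 * (m * ((n : ℝ) + 1)⁻¹) * h n ω ^ 2)
          ((hi4 n).sub ((hi2 n).const_mul _)) (integrable_const _),
        integral_sub (hi4 n) ((hi2 n).const_mul _), integral_const_mul, hvar]
      have := hfour n
      simp only [integral_const, probReal_univ, one_smul]
      nlinarith [sq_nonneg (m * ((n : ℝ) + 1)⁻¹)])
    (ξ := fun n ω =>
      if N ≤ n then quadCoef (T n) ((T n).mulVec (orbit T (fun j => h j ω) v₀ n)) else 0)
    (fun n => by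
      by_cases hn : N ≤ n
      · simpa [hn] using (measurable_coef T hm v₀ n).2
      · simp [hn])
    (K := B / (limBound φ / 2) + (2 * B / (limBound φ / 2)) ^ 2 / 2) (fun n ω => by
      split_ifs with hn
      · exact hquad n hn ω
      · rw [abs_zero]; positivity)
    (c := fun _ => 1) (by
      have : Summable fun n : ℕ => ((n : ℝ) ^ 2)⁻¹ := Real.summable_nat_pow_inv.2 (by norm_num)
      have := ((summable_nat_add_iff 1).2 this).mul_left C
      simpa using this)
  filter_upwards [r1, r2] with ω ⟨l1, hl1⟩ ⟨l2, hl2⟩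
  simp only [one_mul] at hl2
  exact isLittleO_log_form_sub hφ hφ₂ hdet hT hsum (h := fun j => h j ω) (fun _ => rfl) hv₀
    (hcube ω) hN (isLittleO_sum_of_tendsto_sum_div hl1) (isLittleO_harm_of_tendsto hl2)

end Random

/-! ### The Prüfer radius and the conclusion. -/

theorem IsPrufer.form_eq {φ x y R θ : ℝ} (h : IsPrufer φ x y R θ) :
    form (limMat φ) ![x, y] = 4 * Real.sin φ ^ 2 * R ^ 2 := by
  obtain ⟨_, h⟩ := h
  have h0 := congrFun h 0
  have h1 := congrFun h 1
  have e2 : ∀ t : ℝ, Complex.exp (-(Complex.I * t)) = ⟨Real.cos t, -Real.sin t⟩ := fun t => by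
    rw [← mul_neg, ← Complex.ofReal_neg, exp_I_mul_eq, Real.cos_neg, Real.sin_neg]
  simp only [fPlus, fMinus, exp_I_mul_eq, e2, Pi.add_apply, Pi.smul_apply, smul_eq_mul,
    Matrix.cons_val_zero, Matrix.cons_val_one, Matrix.cons_val_fin_one] at h0 h1
  have hx := congrArg Complex.re h0
  have hy := congrArg Complex.re h1
  simp at hx hy
  have hx' : x = -2 * R * Real.sin θ := by rw [hx]; ring
  have hy' : y = -2 * R * Real.sin θ * (1 - Real.cos φ) - 2 * R * Real.cos θ * Real.sin φ := by
    rw [hy]; ring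
  have hθ := Real.sin_sq_add_cos_sq θ
  have hφ := Real.sin_sq_add_cos_sq φ
  simp only [form, limMat]
  simp
  rw [hx', hy']
  linear_combination (4 * R ^ 2 * Real.sin φ ^ 2) * hθ - 4 * R ^ 2 * Real.sin θ ^ 2 * hφ

end DeltaCombModel

open DeltaCombModel in
theorem mainTheorem7 {Ω : Type*} [MeasurableSpace Ω] (ν : Measure Ω) [IsProbabilityMeasure ν]
    -- the geometry of the comb
    (a : ℕ → ℝ) (ha_pos : ∀ n ≥ 1, 0 < a n) (ha_anti : ∀ n ≥ 1, a (n + 1) ≤ a n)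
    (ha_sum : Summable a)
    -- the random couplings `g_n`, `n ≥ 1` (independence contains hypothesis (iv))
    (g : ℕ → Ω → ℝ) (hg_meas : ∀ n ≥ 1, Measurable (g n))
    (hg_indep : iIndepFun (fun n : ℕ => g (n + 1)) ν)
    (lam : ℝ) (hlam : 0 < lam)
    -- (i)
    (hg_var : ∀ n ≥ 1, ∫ ω, (g n ω) ^ 2 ∂ν = lam ^ 2 * (n : ℝ)⁻¹)
    (hg_four : ∃ C₄ > 0, ∀ n ≥ 1, ∫ ω, (g n ω) ^ 4 ∂ν ≤ C₄ * lam ^ 4 * ((n : ℝ) ^ 2)⁻¹)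
    -- (ii)
    (hg_mean : ∀ n ≥ 1, ∫ ω, g n ω ∂ν = 0)
    -- (iii)
    (hg_bdd : ∃ ε > 0, ∃ C₁ > 0, ∀ n ≥ 1, ∀ ω, |g n ω| ≤ C₁ * (n : ℝ) ^ (-(1 / 3) - ε : ℝ))
    -- the quasi-momentum `φ` and the energy `E`
    (φ : ℝ) (hφ : φ ∈ Set.Ioo 0 Real.pi) (hφ₁ : φ ≠ Real.pi / 4) (hφ₂ : φ ≠ Real.pi / 2)
    (hφ₃ : φ ≠ 3 * Real.pi / 4)
    (E : ℝ) (hE : Real.cos φ = 1 - 5 / 6 * E)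
    -- nontrivial initial data, the same for all `ω`
    (c d : ℝ) (hcd : c ≠ 0 ∨ d ≠ 0) :
    ∀ᵐ ω ∂ν, ∀ u du : ℝ → ℝ,
      DeltaCombModel.IsSolution a (fun n => g n ω) E u du → u 0 = c → du 0 = d →
      ∀ R θ : ℕ → ℝ,
        (∀ n, DeltaCombModel.IsPrufer φ (u (DeltaCombModel.bPt a n))
          (du (DeltaCombModel.bPt a n)) (R n) (θ n)) →
        Tendsto (fun n : ℕ => Real.log (R n) / ∑ j ∈ Finset.Icc 1 n, 1 / (j : ℝ)) atTop
          (𝓝 (lam ^ 2 / (8 * Real.sin φ ^ 2))) := by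
  obtain ⟨ε, hε, C₁, hC₁, hbd⟩ := hg_bdd
  obtain ⟨C₄, _, hfour⟩ := hg_four
  have hsin := Real.sin_pos_of_mem_Ioo hφ
  have hE0 : 0 < E := by
    have := (abs_lt.1 (abs_cos_lt_one hφ)).2
    linarith
  set k := √E with hk
  have hk0 : 0 < k := Real.sqrt_pos.2 hE0
  have hkE : k ^ 2 = E := Real.sq_sqrt hE0.le
  set T : ℕ → Matrix (Fin 2) (Fin 2) ℝ := fun n => cellMat k (a (n + 1)) with hT
  have hdet : ∀ n, (T n).det = 1 := fun n => det_cellMat hk0 _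
  have hcell := fun i j => cellMat_tendsto_and_summable hk0 (by rw [hkE]; exact hE)
    (s := fun n => a (n + 1)) (fun n => ha_pos _ (by omega))
    (antitone_nat_of_succ_le fun n => ha_anti _ (by omega))
    ((tendsto_add_atTop_iff_nat 1).2 ha_sum.tendsto_atTop_zero) i j
  have hsum : Summable fun n => entryDist (T (n + 1)) (T n) :=
    (((hcell 0 0).2.add (hcell 0 1).2).add (hcell 1 0).2).add (hcell 1 1).2
  have hb : ∀ n ω, |g (n + 1) ω| ≤ C₁ * ((n : ℝ) + 1) ^ (-(1 / 3) - ε : ℝ) := fun n ω => by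
    simpa using hbd (n + 1) (by omega) ω
  have hv₀ : (![c, d] : Fin 2 → ℝ) ≠ 0 := by
    intro h
    have h0 := congrFun h 0
    have h1 := congrFun h 1
    simp at h0 h1
    tauto
  have main := ae_isLittleO_log_form_sub (h := fun n => g (n + 1)) (ν := ν) hφ hφ₂ hdet
    (fun i j => (hcell i j).1) hsum (fun n => hg_meas _ (by omega)) hg_indep
    (m := lam ^ 2) (C := C₄ * lam ^ 4) (D := C₁)
    (fun n => by simpa using hg_var (n + 1) (by omega))
    (fun n => by simpa using hfour (n + 1) (by omega))
    (fun n => hg_mean _ (by omega))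
    (fun n ω => (hb n ω).trans (mul_le_of_le_one_right hC₁.le
      (Real.rpow_le_one_of_one_le_of_nonpos (by linarith [show (0 : ℝ) ≤ n by positivity])
        (by linarith))))
    -- Cubing the bound `n^(-1/3-ε)` gives the exponent `-1 - 3ε`, just below the threshold of
    -- summability.
    (fun ω => by
      have hs : Summable fun n : ℕ => C₁ ^ 3 * ((n : ℝ) + 1) ^ (-1 - 3 * ε) := by
        have := (summable_nat_add_iff 1).2
          (Real.summable_nat_rpow.2 (by linarith : -1 - 3 * ε < -1))
        simpa using this.mul_left (C₁ ^ 3)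
      refine Summable.of_nonneg_of_le (fun n => by positivity) (fun n => ?_) hs
      calc |g (n + 1) ω| ^ 3 ≤ (C₁ * ((n : ℝ) + 1) ^ (-(1 / 3) - ε : ℝ)) ^ 3 := by
            gcongr; exact hb n ω
        _ = C₁ ^ 3 * ((n : ℝ) + 1) ^ (-1 - 3 * ε) := by
            rw [mul_pow, ← Real.rpow_natCast (((n : ℝ) + 1) ^ _), ← Real.rpow_mul (by positivity)]
            congr 2
            push_cast
            ring)
    hv₀
  -- The exceptional set concerns only the orbit of `(c, d)`, so it is fixed before the solution and
  -- its Prüfer variables are chosen.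
  filter_upwards [main] with ω hω u du hu hu0 hdu0 R θ hR
  have horb : ∀ n, ![u (bPt a n), du (bPt a n)] = orbit T (fun j => g (j + 1) ω) ![c, d] n := by
    intro n
    induction n with
    | zero => rw [bPt_zero, hu0, hdu0]; rfl
    | succ n ih =>
      rw [← hkE] at hu
      rw [hu.transfer hk0 ha_pos ha_sum n, ih]
      rfl
  have hform : ∀ n, Real.log (form (limMat φ) (orbit T (fun j => g (j + 1) ω) ![c, d] n)) =
      Real.log (4 * Real.sin φ ^ 2) + 2 * Real.log (R n) := fun n => by
    rw [← horb, (hR n).form_eq, Real.log_mul (by positivity) (pow_pos (hR n).1 2).ne',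
      Real.log_pow]
    norm_num
  have hconst := isLittleO_harm_of_tendsto
    (tendsto_const_nhds (x := Real.log (4 * Real.sin φ ^ 2)) (f := (atTop : Filter ℕ)))
  -- The factor `1/2` undoes the square in `form = 4 sin² φ · R²` and turns `4` into the `8` of the
  -- limit.
  have hlim := ((hω.sub hconst).const_mul_left (1 / 2)).tendsto_div_nhds_zero.add_const
    (lam ^ 2 / (8 * Real.sin φ ^ 2))
  rw [zero_add] at hlim
  refine hlim.congr' ?_
  filter_upwards [harm_tendsto.eventually_gt_atTop 0] with n hn
  rw [hform, ← harm_eq_sum_Icc]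
  field_simp
  ring
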